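/- Let $\mathbb T$ be the triangular lattice, with vertex set $\mathcal V$ and edge set $\mathcal E$. For $p\in[0,1]$ let $\nu_{p,2}$ denote the random-cluster measure on $\{0,1\}^{\mathcal E}$ with parameters $p$ and $q=2$, that is, the weak limit as $n\to\infty$ of the random-cluster measures on the finite boxes $\{(k,l):|k|,|l|\le n\}$ (in lattice coordinates) with free boundary condition, which give an edge configuration in the box a probability proportional to $p^{\#\text{open edges}}(1-p)^{\#\text{closed edges}}2^{\#\text{clusters}}$. Let $p_c(2)$ be the supremum of those $p \in [0,1]$ for which the open cluster of the origin is $\nu_{p,2}$-a.s. finite, and let $\beta_c$ (the critical inverse temperature of the Ising model on $\mathbb T$) be given by $p_c(2)=1-e^{-\beta_c}$. Let $0\le\beta<\beta_c$ and $r\in[0,1]$. Let $\mathbb P_{\beta,r}$ be the law of the pair $(\eta,\sigma)\in\{0,1\}^{\mathcal E}\times\{-1,+1\}^{\mathcal V}$ obtained as follows: $\eta$ has law $\nu_{p,2}$ with $p=1-e^{-\beta}$ and, given $\eta$, the FK clusters (the connected components of the graph formed by all vertices and the open edges, those with $\eta(e)=1$; edges with $\eta(e)=0$ are closed) receive independent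 spins, each $+1$ with probability $r$ and $-1$ with probability $1-r$, all vertices of a cluster having the spin of the cluster. Let $\tilde\Omega$ be the set of pairs $(\eta,\sigma)$ for which $\sigma$ is constant on the FK clusters of $\eta$. An event $D$ is increasing if $(\eta,\sigma)\in D$ implies $(\eta',\sigma')\in D$ whenever $(\eta,\sigma),(\eta',\sigma')\in\tilde\Omega$ and $\sigma'(x)\ge\sigma(x)$ for all $x\in\mathcal V$. A finite edge set is a barrier if its removal (keeping the end-vertices) leaves at least two connected components, of which exactly one is infinite; the vertex set of the infinite component is the exterior of the barrier. Let $V\subset\mathcal V$ be a finite, non-empty, connected set of vertices, and let $B=\Delta V$ be its edge boundary, i.e. the set of edges with exactly one end-vertex in $V$. Consider the events $I=\{\sigma(v)=-1 \text{ for all } v\in V\}$ and $C(B)=\{\eta(e)=0\text{ for all } e\in B\}$. Then $B$ is a barrier, and: (a) for every increasing event $D$, $$\mathbb P_{\beta,r}(D\mid C(B))\ \ge\ \mathbb P_{\beta,r}(D\mid I);$$ (b) for every increasing event $D$ in the $\sigma$-algebra generated by the spins of the vertices in the exterior of $B$, $$\mathbb P_{\beta,r}(D\mid C(B)\cap I)\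 \ge\ \mathbb P_{\beta,r}(D\mid I).$$ (For $r=1$, where $I$ has probability $0$, conditional probabilities given events of probability $0$ are read as $0$.) -/

import Mathlib

open MeasureTheory ProbabilityTheory Filter Topology

namespace TriFK

/-! ### The triangular lattice -/

/-- A vertex `(k, l)` stands for the point of the plane with Cartesian coordinates
`(k - l / 2, (√3 / 2) * l)`, the intersection of the lines `y = -√3 x + √3 k` and
`y = (√3 / 2) l`. -/
abbrev Vertex : Type := ℤ × ℤ

/-- The triangular lattice: two vertices are adjacent iff their Euclidean distance is `1`.
In the coordinates `(k, l)`, the squared distance is `Δk ^ 2 - Δk * Δl + Δl ^ 2`. -/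
def triangularLattice : SimpleGraph Vertex where
  Adj v w := (v.1 - w.1) ^ 2 - (v.1 - w.1) * (v.2 - w.2) + (v.2 - w.2) ^ 2 = 1
  symm := ⟨fun v w h => by linear_combination h⟩
  loopless := ⟨fun v h => by simp at h⟩

/-- The edges of the triangular lattice. -/
abbrev Edge : Type := triangularLattice.edgeSet

/-- Edge configurations `η ∈ {0,1}^E`; `true` is open (`1`), `false` is closed (`0`). -/
abbrev EdgeConfig : Type := Edge → Bool

/-- Spin configurations `σ ∈ {-1,+1}^V`; `true` is `+1`, `false` is `-1`. They are ordered
pointwise, with `false < true`. -/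
abbrev SpinConfig : Type := Vertex → Bool

/-- The configuration space, with its product σ-algebra. -/
abbrev Config : Type := EdgeConfig × SpinConfig

/-- The graph on all vertices that keeps exactly the open edges of `η`; its connected
components are the FK clusters. -/
def openGraph (η : EdgeConfig) : SimpleGraph Vertex where
  Adj v w := ∃ h : triangularLattice.Adj v w, η ⟨s(v, w), h⟩ = true
  symm := ⟨fun v w ⟨h, ho⟩ => ⟨h.symm, by
    have : (⟨s(w, v), h.symm⟩ : Edge) = ⟨s(v, w), h⟩ := Subtype.ext Sym2.eq_swap
    rw [this]; exact ho⟩⟩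
  loopless := ⟨fun v ⟨h, _⟩ => h.ne rfl⟩

/-- The vertex set of the FK cluster of `v`. -/
def fkCluster (η : EdgeConfig) (v : Vertex) : Set Vertex :=
  {w | (openGraph η).Reachable v w}

/-! ### Random-cluster measures -/

/-- The box `{(k, l) : |k| ≤ n, |l| ≤ n}`. -/
noncomputable def box (n : ℕ) : Finset Vertex :=
  Finset.Icc (-(n : ℤ)) n ×ˢ Finset.Icc (-(n : ℤ)) n

open Classical in
/-- The edges with both end-vertices in `Λ`. -/
noncomputable def edgesIn (Λ : Finset Vertex) : Finset Edge :=
  Λ.sym2.subtype (· ∈ triangularLattice.edgeSet)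

open Classical in
/-- The edge configuration whose open edges are exactly those of `A`. -/
noncomputable def configOf (A : Finset Edge) : EdgeConfig := fun e => decide (e ∈ A)

/-- The number of FK clusters of `η` that meet `Λ`. -/
noncomputable def numClusters (Λ : Finset Vertex) (η : EdgeConfig) : ℕ :=
  ((openGraph η).connectedComponentMk '' (Λ : Set Vertex)).ncard

/-- The weight `p ^ #open * (1 - p) ^ #closed * q ^ #clusters` of the configuration in `Λ` whose
open edges are those of `A ⊆ edgesIn Λ`. -/
noncomputable def rcWeight (p q : ℝ) (Λ : Finset Vertex) (A : Finset Edge) : ℝ :=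
  p ^ A.card * (1 - p) ^ ((edgesIn Λ).card - A.card) * q ^ numClusters Λ (configOf A)

open Classical in
/-- The probability of `S` under the random-cluster measure on the finite graph spanned by `Λ`
(free boundary condition: all edges outside `Λ` are closed). -/
noncomputable def rcProb (p q : ℝ) (Λ : Finset Vertex) (S : Set EdgeConfig) : ℝ :=
  (∑ A ∈ (edgesIn Λ).powerset with configOf A ∈ S, rcWeight p q Λ A) /
    ∑ A ∈ (edgesIn Λ).powerset, rcWeight p q Λ A

/-- `ν` is the random-cluster measure with parameters `p` and `q` on the triangular lattice: the
weak limit (convergence on all cylinder events) of the random-cluster measures on the boxes.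
For `p < pc q` this is the only random-cluster measure. -/
structure IsRandomClusterMeasure (p q : ℝ) (ν : Measure EdgeConfig) : Prop where
  isProbabilityMeasure : IsProbabilityMeasure ν
  tendsto_cylinder : ∀ (F : Finset Edge) (ζ : EdgeConfig),
    Tendsto (fun n : ℕ => rcProb p q (box n) {η | ∀ e ∈ F, η e = ζ e}) atTop
      (𝓝 (ν.real {η | ∀ e ∈ F, η e = ζ e}))

/-- The critical point of the random-cluster measure: the supremum of the `p ∈ [0,1]` for which
the FK cluster of the origin is almost surely finite. -/
noncomputable def pc (q : ℝ) : ℝ :=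
  sSup {p | 0 ≤ p ∧ p ≤ 1 ∧ ∃ ν : Measure EdgeConfig, IsRandomClusterMeasure p q ν ∧
    ∀ᵐ η ∂ν, (fkCluster η (0, 0)).Finite}

/-- The critical inverse temperature of the Ising model, `pc 2 = 1 - exp (-betaC)`. -/
noncomputable def betaC : ℝ := -Real.log (1 - pc 2)

/-! ### The spin percolation model -/

/-- A label of the FK cluster of `v`, the same for all vertices of the cluster and different for
different clusters: the least code of a vertex of the cluster in a fixed enumeration. -/
noncomputable def clusterLabel (η : EdgeConfig) (v : Vertex) : ℕ :=
  sInf (Encodable.encode '' fkCluster η v)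

/-- Given the edge configuration `η` and one coin `τ i` for every label `i`, all vertices of an FK
cluster receive the coin of that cluster as their spin. -/
noncomputable def colour (x : EdgeConfig × (ℕ → Bool)) : Config :=
  (x.1, fun v => x.2 (clusterLabel x.1 v))

/-- The law of `(η, σ)`, where `η` has law `ν` and, given `η`, the FK clusters receive independent
spins, each `+1` with probability `r` and `-1` with probability `1 - r`. -/
noncomputable def divideAndColour (ν : Measure EdgeConfig) (r : unitInterval) : Measure Config :=
  (ν.prod (Measure.infinitePi fun _ : ℕ => bernoulliMeasure true false r)).map colour

theorem measurableSet_reachable (v w : Vertex) :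
    MeasurableSet {η : EdgeConfig | (openGraph η).Reachable v w} := by
  have hstep : ∀ a b : Vertex, MeasurableSet {η : EdgeConfig | (openGraph η).Adj a b} := by
    intro a b
    by_cases h : triangularLattice.Adj a b
    · have : {η : EdgeConfig | (openGraph η).Adj a b} =
          (fun η : EdgeConfig => η ⟨s(a, b), h⟩) ⁻¹' {true} := by
        ext η; simp [openGraph, h]
      rw [this]
      exact measurable_pi_apply _ (measurableSet_singleton _)
    · have : {η : EdgeConfig | (openGraph η).Adj a b} = ∅ := by
        ext η; simp [openGraph, h]
      rw [this]; exact MeasurableSet.empty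
  have hlen : ∀ (n : ℕ) (a : Vertex),
      MeasurableSet {η : EdgeConfig | ∃ p : (openGraph η).Walk a w, p.length = n} := by
    intro n
    induction n with
    | zero =>
      intro a
      by_cases h : a = w
      · subst h
        convert MeasurableSet.univ
        refine Set.eq_univ_of_forall fun η => ⟨SimpleGraph.Walk.nil, rfl⟩
      · convert MeasurableSet.empty
        refine Set.eq_empty_of_forall_notMem fun η ⟨p, hp⟩ => h ?_
        exact SimpleGraph.Walk.eq_of_length_eq_zero hp
    | succ n ih =>
      intro a
      have : {η : EdgeConfig | ∃ p : (openGraph η).Walk a w, p.length = n + 1} =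
          ⋃ b : Vertex, {η : EdgeConfig | (openGraph η).Adj a b} ∩
            {η : EdgeConfig | ∃ p : (openGraph η).Walk b w, p.length = n} := by
        ext η
        simp only [Set.mem_ofPred_eq, Set.mem_iUnion, Set.mem_inter_iff]
        constructor
        · rintro ⟨p, hp⟩
          cases p with
          | nil => simp at hp
          | cons h p => exact ⟨_, h, p, by simpa using hp⟩
        · rintro ⟨b, h, p, hp⟩
          exact ⟨SimpleGraph.Walk.cons h p, by simp [hp]⟩
      rw [this]
      exact MeasurableSet.iUnion fun b => (hstep a b).inter (ih b)
  have : {η : EdgeConfig | (openGraph η).Reachable v w} =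
      ⋃ n : ℕ, {η : EdgeConfig | ∃ p : (openGraph η).Walk v w, p.length = n} := by
    ext η
    simp only [Set.mem_ofPred_eq, Set.mem_iUnion]
    exact ⟨fun ⟨p⟩ => ⟨_, p, rfl⟩, fun ⟨_, p, _⟩ => ⟨p⟩⟩
  rw [this]
  exact MeasurableSet.iUnion fun n => hlen n v

theorem measurable_clusterLabel (v : Vertex) :
    Measurable fun η : EdgeConfig => clusterLabel η v := by
  have hmem : ∀ m : ℕ, MeasurableSet {η : EdgeConfig | m ∈ Encodable.encode '' fkCluster η v} := by
    intro m
    have : {η : EdgeConfig | m ∈ Encodable.encode '' fkCluster η v} =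
        ⋃ w : Vertex, ⋃ _ : Encodable.encode w = m,
          {η : EdgeConfig | (openGraph η).Reachable v w} := by
      ext η
      simp [fkCluster, and_comm]
    rw [this]
    exact MeasurableSet.iUnion fun w => MeasurableSet.iUnion fun _ => measurableSet_reachable v w
  refine measurable_to_countable' fun n => ?_
  have : (fun η : EdgeConfig => clusterLabel η v) ⁻¹' {n} =
      {η : EdgeConfig | n ∈ Encodable.encode '' fkCluster η v} ∩
        ⋂ m : ℕ, ⋂ _ : m < n, {η : EdgeConfig | m ∈ Encodable.encode '' fkCluster η v}ᶜ := by
    ext η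
    have hne : (Encodable.encode '' fkCluster η v).Nonempty :=
      ⟨_, v, SimpleGraph.Reachable.refl v, rfl⟩
    simp only [Set.mem_preimage, Set.mem_singleton_iff, Set.mem_inter_iff, Set.mem_iInter,
      Set.mem_compl_iff]
    constructor
    · rintro rfl
      exact ⟨Nat.sInf_mem hne, fun m hm => Nat.notMem_of_lt_sInf hm⟩
    · rintro ⟨h1, h2⟩
      exact le_antisymm (Nat.sInf_le h1) (not_lt.1 fun h => h2 _ h (Nat.sInf_mem hne))
  rw [this]
  exact (hmem n).inter (MeasurableSet.iInter fun m => MeasurableSet.iInter fun _ => (hmem m).compl)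

/-- `colour` is measurable, so that `divideAndColour` is a genuine image measure. -/
theorem measurable_colour : Measurable colour := by
  refine measurable_fst.prodMk (measurable_pi_lambda _ fun v => ?_)
  have : Measurable fun y : (ℕ → Bool) × ℕ => y.1 y.2 :=
    measurable_from_prod_countable_left fun n => measurable_pi_apply n
  exact this.comp (measurable_snd.prodMk ((measurable_clusterLabel v).comp measurable_fst))

/-! ### Events -/

/-- The set of configurations in which vertices of the same FK cluster have the same spin. -/
def compatible : Set Config :=
  {ω | ∀ v w, (openGraph ω.1).Reachable v w → ω.2 v = ω.2 w}

/-- Increasing events; only the spins of the compatible configurations are compared. -/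
def IsIncreasing (D : Set Config) : Prop :=
  ∀ ω ∈ compatible, ∀ ω' ∈ compatible, ω.2 ≤ ω'.2 → ω ∈ D → ω' ∈ D

/-- The event that all edges of `B` are closed. -/
def allClosed (B : Set Edge) : Set Config := {ω | ∀ e ∈ B, ω.1 e = false}

/-- The event that all vertices of `V` have spin `-1`. -/
def allMinus (V : Set Vertex) : Set Config := {ω | ∀ v ∈ V, ω.2 v = false}

/-- The σ-algebra generated by the spins of the vertices of `W`. -/
@[reducible] def spinSigma (W : Set Vertex) : MeasurableSpace Config :=
  ⨆ x ∈ W, MeasurableSpace.comap (fun ω : Config => ω.2 x) inferInstance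

/-! ### Barriers -/

/-- The edges with exactly one end-vertex in `V`. -/
def edgeBoundary (V : Set Vertex) : Set Edge :=
  {e | ∃ x ∈ V, ∃ y ∉ V, (e : Sym2 Vertex) = s(x, y)}

/-- The lattice after removal of the edges of `E` (but not of their end-vertices). -/
def removeEdges (E : Set Edge) : SimpleGraph Vertex :=
  triangularLattice.deleteEdges (Subtype.val '' E)

/-- A barrier: a finite set of edges whose removal leaves two or more connected components, of
which exactly one is infinite. -/
def IsBarrier (E : Set Edge) : Prop :=
  E.Finite ∧ Nontrivial (removeEdges E).ConnectedComponent ∧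
    ∃! c : (removeEdges E).ConnectedComponent, c.supp.Infinite

/-- The (vertex set of the) exterior of a barrier `E`: the vertices that lie in the infinite
component left by the removal of `E`. -/
def ext (E : Set Edge) : Set Vertex :=
  {v | ((removeEdges E).connectedComponentMk v).supp.Infinite}

end TriFK

namespace TriFK

/-! ### Two-colourings of the clusters of a finite box -/

/-! With $q=2$ and $y=p/(1-p)$, the weight of an edge set in a finite box is, up to a constant,
$y^{|\eta|}$ times the number of two-colourings of the vertices that are constant on clusters.
`spinWeight` adds planting: clusters that meet a set `B` lose their factor 2 and have spin $-1$. Two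
identities reveal the model piece by piece. An edge with an end in `B` is either closed or open, and
in the latter case it contributes `y` and plants its other end (`spinWeight_insert_edge`). If no
edge touches `B`, then requiring $-1$ at a new vertex amounts to planting there, up to a factor
$2(1-r)$ that does not depend on the event (`spinWeight_minus_of_isolated`).

Planting lowers the probability of increasing spin events (`spinWeight_plant_le`). To see this,
reveal an edge at `B`: in both outcomes induction gives the comparison, and planting makes the
outcome "open", which is the worse one for increasing events, more likely. The last point is a
lattice inequality for counts of colourings (`card_colourings_mul_le`) fed into the four functions
theorem; `mix_le` combines the two outcomes. The same exploration compares the model conditioned on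
$-1$ on `U` with the unconditioned model on fewer edges (`spinWeight_minus_mul_le`). This gives (a).
No correlation inequality for the spins under general $r$ is needed, since only vertices already
known to be $-1$ are explored from.

For (b), closing the boundary of $V$ decouples inside from outside: given $I$, the spins then have
the law of the model without edges touching $V$ and with $V$ planted. Composing the event with
`setMinus` reduces this to the same comparison.

In infinite volume, the conditional probability of a local spin event given the edges depends on
finitely many connection events. These are not cylinder events, but they are increasing limits of
such, and monotonicity of the free measures in the box makes their probabilities converge
(`tendsto_rcMeasure_of_isOpenUp`). Compactness extends the inequality from local to all measurable
increasing spin events (`measure_le_of_local_le`), and on compatible configurations every increasing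
event is a spin event. -/

/-- The two-colouring with set `c` of vertices of the first colour is constant on the edge `e`. -/
def Agrees (c : Finset Vertex) (e : Edge) : Prop :=
  ∀ v ∈ e.1, ∀ w ∈ e.1, v ∈ c → w ∈ c

open Classical in
/-- The two-colourings of `Λ`, constant on the clusters of `η`, with the second colour on `B`. -/
noncomputable def colourings (Λ : Finset Vertex) (η : Finset Edge) (B : Finset Vertex) :
    Finset (Finset Vertex) :=
  {c ∈ Λ.powerset | (∀ e ∈ η, Agrees c e) ∧ ∀ b ∈ B, b ∉ c}

variable {Λ B B₁ B₂ : Finset Vertex} {η η₁ η₂ K E E₁ E₂ : Finset Edge} {e : Edge} {b u v w x : Vertex}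
  {c : Finset Vertex}

theorem mem_colourings :
    c ∈ colourings Λ η B ↔ c ⊆ Λ ∧ (∀ e ∈ η, Agrees c e) ∧ ∀ b ∈ B, b ∉ c := by
  simp [colourings]

theorem agrees_iff (he : e.1 = s(v, w)) : Agrees c e ↔ (v ∈ c ↔ w ∈ c) := by
  simp only [Agrees, he, Sym2.mem_iff]
  constructor
  · intro h
    exact ⟨h v (.inl rfl) w (.inr rfl), h w (.inr rfl) v (.inl rfl)⟩
  · rintro h a (rfl | rfl) b (rfl | rfl) <;> simp_all

theorem exists_ends (e : Edge) : ∃ v w, e.1 = s(v, w) ∧ triangularLattice.Adj v w := by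
  obtain ⟨e, he⟩ := e
  induction e using Sym2.ind with
  | _ v w => exact ⟨v, w, rfl, he⟩

theorem empty_mem_colourings : ∅ ∈ colourings Λ η B := by
  simp [mem_colourings, Agrees]

theorem colourings_anti (hη : η₁ ⊆ η₂) (hB : B₁ ⊆ B₂) :
    colourings Λ η₂ B₂ ⊆ colourings Λ η₁ B₁ := by
  intro c
  simp only [mem_colourings]
  exact fun ⟨h1, h2, h3⟩ => ⟨h1, fun e he => h2 e (hη he), fun b hb => h3 b (hB hb)⟩

/-- Under symmetric difference the colourings form vector spaces over $\mathbb F_2$. The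
intersection of the two spaces on the left belongs to the unions of the constraints, and their sum
lies in the space for the intersections, so this is $\dim X+\dim Y=\dim(X+Y)+\dim(X\cap Y)$. -/
theorem card_colourings_mul_le (η₁ η₂ : Finset Edge) (B₁ B₂ : Finset Vertex) :
    (colourings Λ η₁ B₁).card * (colourings Λ η₂ B₂).card ≤
      (colourings Λ (η₁ ∩ η₂) (B₁ ∩ B₂)).card * (colourings Λ (η₁ ∪ η₂) (B₁ ∪ B₂)).card := by
  classical
  have key : ∀ {η : Finset Edge} {B : Finset Vertex} {c d : Finset Vertex},
      c ∈ colourings Λ η B → d ∈ colourings Λ η B → symmDiff c d ∈ colourings Λ η B := by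
    intro η B c d hc hd
    rw [mem_colourings] at *
    refine ⟨fun a ha => ?_, fun e he => ?_, fun b hb => ?_⟩
    · rcases Finset.mem_symmDiff.1 ha with h | h
      exacts [hc.1 h.1, hd.1 h.1]
    · obtain ⟨v, w, hvw, -⟩ := exists_ends e
      have h1 := (agrees_iff hvw).1 (hc.2.1 e he)
      have h2 := (agrees_iff hvw).1 (hd.2.1 e he)
      rw [agrees_iff hvw, Finset.mem_symmDiff, Finset.mem_symmDiff, h1, h2]
    · simp [Finset.mem_symmDiff, hc.2.2 b hb, hd.2.2 b hb]
  rw [← Finset.card_product, mul_comm]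
  -- Count pairs by the fibres of addition. Subtracting a fixed pair of the fibre from another one
  -- gives the same vector in both coordinates, hence an element of the intersection of the spaces.
  refine (Finset.card_le_mul_card_image (f := fun q => symmDiff q.1 q.2) _
    (colourings Λ (η₁ ∪ η₂) (B₁ ∪ B₂)).card ?_).trans
    (Nat.mul_le_mul_left _ (Finset.card_le_card ?_))
  · intro d hd
    obtain ⟨⟨c₁, c₂⟩, hc, rfl⟩ := Finset.mem_image.1 hd
    rw [Finset.mem_product] at hc
    refine Finset.card_le_card_of_injOn (fun q => symmDiff q.1 c₁) ?_ ?_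
    · rintro ⟨d₁, d₂⟩ hq
      simp only [Finset.coe_filter, Finset.mem_product, Set.mem_ofPred_eq] at hq
      obtain ⟨⟨h1, h2⟩, h3⟩ := hq
      have h4 : symmDiff d₁ c₁ = symmDiff d₂ c₂ := by
        have : symmDiff (symmDiff d₁ d₂) (symmDiff c₁ d₂)
          = symmDiff (symmDiff c₁ c₂) (symmDiff c₁ d₂) := by rw [h3]
        rw [symmDiff_symmDiff_symmDiff_comm, symmDiff_self, symmDiff_bot] at this
        rw [this, symmDiff_symmDiff_symmDiff_comm, symmDiff_self, bot_symmDiff, symmDiff_comm]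
      have h5 := mem_colourings.1 (key h1 hc.1)
      have h6 := mem_colourings.1 (key h2 hc.2)
      simp only at h4 h5 h6 ⊢
      rw [← h4] at h6
      rw [Finset.mem_coe, mem_colourings]
      refine ⟨h5.1, fun e he => ?_, fun b hb => ?_⟩
      · rcases Finset.mem_union.1 he with h | h
        exacts [h5.2.1 e h, h6.2.1 e h]
      · rcases Finset.mem_union.1 hb with h | h
        exacts [h5.2.2 b h, h6.2.2 b h]
    · rintro ⟨d₁, d₂⟩ hq ⟨d₁', d₂'⟩ hq' h
      simp only [Finset.coe_filter, Finset.mem_product, Set.mem_ofPred_eq] at hq hq' h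
      have h1 : d₁ = d₁' := symmDiff_left_injective c₁ h
      subst h1
      have h2 : d₂ = d₂' := symmDiff_right_injective d₁ (hq.2.trans hq'.2.symm)
      rw [h2]
  · intro d hd
    obtain ⟨⟨c₁, c₂⟩, hc, rfl⟩ := Finset.mem_image.1 hd
    rw [Finset.mem_product] at hc
    exact key (colourings_anti Finset.inter_subset_left Finset.inter_subset_left hc.1)
      (colourings_anti Finset.inter_subset_right Finset.inter_subset_right hc.2)

/-- Agreement along `e` forces on `x` the second colour that `b` already has. -/
theorem colourings_insert (he : e.1 = s(b, x)) (hb : b ∈ B) :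
    colourings Λ (insert e η) B = colourings Λ η (insert x B) := by
  ext c
  simp only [mem_colourings, Finset.forall_mem_insert, agrees_iff he]
  grind

/-- Interchanging the colours outside `B` shows that an isolated vertex has both colours equally
often. -/
theorem card_colourings_eq_two_mul (hη : ∀ e ∈ η, ∀ v ∈ e.1, v ∈ Λ)
    (hB : ∀ e ∈ η, ∀ v ∈ e.1, v ∉ B) (hu : u ∈ Λ) (huB : u ∉ B) :
    (colourings Λ η B).card = 2 * (colourings Λ η (insert u B)).card := by
  classical
  have h1 : colourings Λ η (insert u B) = (colourings Λ η B).filter (fun c => ¬ u ∈ c) := by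
    ext c
    simp only [mem_colourings, Finset.forall_mem_insert, Finset.mem_filter]
    tauto
  -- The flip respects every edge because no edge of `η` meets `B`, where the colour stays fixed.
  have hmem : ∀ c ∈ colourings Λ η B, (Λ \ B) \ c ∈ colourings Λ η B := by
    intro c hc
    rw [mem_colourings] at *
    refine ⟨fun a ha => ?_, fun e he => ?_, fun b hb => ?_⟩
    · simp only [Finset.mem_sdiff] at ha
      exact ha.1.1
    · obtain ⟨v, w, hvw, -⟩ := exists_ends e
      have h2 := (agrees_iff hvw).1 (hc.2.1 e he)
      have hv : v ∈ e.1 := by simp [hvw]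
      have hw : w ∈ e.1 := by simp [hvw]
      rw [agrees_iff hvw]
      simp [hη e he v hv, hη e he w hw, hB e he v hv, hB e he w hw, h2]
    · simp [hb]
  have hinv : ∀ c ∈ colourings Λ η B, (Λ \ B) \ ((Λ \ B) \ c) = c := by
    intro c hc
    rw [mem_colourings] at hc
    rw [Finset.sdiff_sdiff_eq_self]
    intro a ha
    exact Finset.mem_sdiff.2 ⟨hc.1 ha, fun h => hc.2.2 a h ha⟩
  have h2 : ((colourings Λ η B).filter (fun c => u ∈ c)).card =
      ((colourings Λ η B).filter (fun c => ¬ u ∈ c)).card := by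
    refine Finset.card_nbij' (fun c => (Λ \ B) \ c) (fun c => (Λ \ B) \ c) ?_ ?_ ?_ ?_
    · intro c hc
      simp only [Finset.coe_filter, Set.mem_ofPred_eq] at hc ⊢
      exact ⟨hmem c hc.1, by simp [hc.2]⟩
    · intro c hc
      simp only [Finset.coe_filter, Set.mem_ofPred_eq] at hc ⊢
      exact ⟨hmem c hc.1, by simp [hc.2, hu, huB]⟩
    · intro c hc
      simp only [Finset.coe_filter, Set.mem_ofPred_eq] at hc
      exact hinv c hc.1
    · intro c hc
      simp only [Finset.coe_filter, Set.mem_ofPred_eq] at hc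
      exact hinv c hc.1
  rw [h1, ← Finset.card_filter_add_card_filter_not (s := colourings Λ η B) (fun c => u ∈ c), h2]
  ring

open Classical in
/-- The four functions theorem for the random-cluster weights. -/
theorem sum_mul_sum_le {y : ℝ} (hy : 0 ≤ y) (S : Finset Edge → Prop)
    (hS : ∀ s t, s ⊆ t → S s → S t) (E₁ E₂ : Finset Edge) (B₁ B₂ : Finset Vertex) :
    (∑ η ∈ E₁.powerset with S η, y ^ η.card * (colourings Λ η B₁).card) *
        (∑ η ∈ E₂.powerset, y ^ η.card * ((colourings Λ η B₂).card : ℝ)) ≤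
      (∑ η ∈ (E₁ ∩ E₂).powerset, y ^ η.card * ((colourings Λ η (B₁ ∩ B₂)).card : ℝ)) *
        ∑ η ∈ (E₁ ∪ E₂).powerset with S η, y ^ η.card * ((colourings Λ η (B₁ ∪ B₂)).card : ℝ) := by
  -- The two power sets become the families of pairwise intersections and pairwise unions, the form
  -- in which the four functions theorem applies.
  rw [Finset.powerset_inter, Finset.powerset_union]
  simp only [Finset.sum_filter]
  have pos : ∀ (B : Finset Vertex) (η : Finset Edge),
      0 ≤ y ^ η.card * ((colourings Λ η B).card : ℝ) := fun B η => by positivity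
  have := Finset.four_functions_theorem (β := ℝ)
    (f₁ := fun η => if S η then y ^ η.card * ((colourings Λ η B₁).card : ℝ) else 0)
    (f₂ := fun η => y ^ η.card * ((colourings Λ η B₂).card : ℝ))
    (f₃ := fun η => y ^ η.card * ((colourings Λ η (B₁ ∩ B₂)).card : ℝ))
    (f₄ := fun η => if S η then y ^ η.card * ((colourings Λ η (B₁ ∪ B₂)).card : ℝ) else 0)
    (E₁ ∪ E₂)
    (fun η => by dsimp only; split_ifs; exacts [pos _ _, le_rfl]) (pos _) (pos _)
    (fun η => by dsimp only; split_ifs; exacts [pos _ _, le_rfl]) ?_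
    (𝒜 := E₁.powerset) (ℬ := E₂.powerset)
    (Finset.powerset_mono.2 Finset.subset_union_left)
    (Finset.powerset_mono.2 Finset.subset_union_right)
  · exact this
  · intro s _ t _
    by_cases h : S s
    · have h' : S (s ∪ t) := hS _ _ Finset.subset_union_left h
      simp only [h, h', if_true]
      have h1 : (((colourings Λ s B₁).card : ℝ) * (colourings Λ t B₂).card) ≤
          (colourings Λ (s ∩ t) (B₁ ∩ B₂)).card * (colourings Λ (s ∪ t) (B₁ ∪ B₂)).card := by
        exact_mod_cast card_colourings_mul_le s t B₁ B₂
      have h2 : y ^ s.card * y ^ t.card = y ^ (s ∩ t).card * y ^ (s ∪ t).card := by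
        rw [← pow_add, ← pow_add, add_comm (s ∩ t).card, Finset.card_union_add_card_inter]
      calc _ = (y ^ s.card * y ^ t.card) *
            (((colourings Λ s B₁).card : ℝ) * (colourings Λ t B₂).card) := by ring
        _ ≤ (y ^ s.card * y ^ t.card) * ((colourings Λ (s ∩ t) (B₁ ∩ B₂)).card *
            (colourings Λ (s ∪ t) (B₁ ∪ B₂)).card) :=
            mul_le_mul_of_nonneg_left h1 (by positivity)
        _ = _ := by rw [h2]; ring
    · simp only [h, if_false, zero_mul]
      split_ifs
      · exact mul_nonneg (pos _ _) (pos _ _)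
      · simp

end TriFK

namespace TriFK

variable {Λ B B₁ B₂ : Finset Vertex} {η η₁ η₂ K E E₁ E₂ : Finset Edge} {e : Edge} {b u v w x : Vertex}
  {c : Finset Vertex}

/-! ### Clusters of finite edge sets -/

theorem configOf_eq_true {A : Finset Edge} : configOf A e = true ↔ e ∈ A := by
  simp [configOf]

theorem openGraph_mono {η η' : EdgeConfig} (h : ∀ e, η e = true → η' e = true) :
    openGraph η ≤ openGraph η' := by
  rintro v w ⟨h1, h2⟩
  exact ⟨h1, h _ h2⟩

theorem mem_of_reachable {G : SimpleGraph Vertex} {T : Set Vertex}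
    (hT : ∀ a a', G.Adj a a' → a ∈ T → a' ∈ T) (hv : v ∈ T) (h : G.Reachable v w) : w ∈ T := by
  obtain ⟨p⟩ := h
  induction p with
  | nil => exact hv
  | cons hadj p ih => exact ih (hT _ _ hadj hv)

theorem clusterLabel_congr {η : EdgeConfig} (h : (openGraph η).Reachable v w) :
    clusterLabel η v = clusterLabel η w := by
  have : fkCluster η v = fkCluster η w := by
    ext a
    exact ⟨fun h' => h.symm.trans h', fun h' => h.trans h'⟩
  simp [clusterLabel, this]

theorem exists_encode_eq_clusterLabel (η : EdgeConfig) (v : Vertex) :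
    ∃ w, (openGraph η).Reachable v w ∧ Encodable.encode w = clusterLabel η v := by
  have hne : (Encodable.encode '' fkCluster η v).Nonempty :=
    ⟨_, v, SimpleGraph.Reachable.refl v, rfl⟩
  exact Nat.sInf_mem hne

theorem reachable_of_clusterLabel_eq {η : EdgeConfig} (h : clusterLabel η v = clusterLabel η w) :
    (openGraph η).Reachable v w := by
  obtain ⟨a, ha, ha'⟩ := exists_encode_eq_clusterLabel η v
  obtain ⟨a', hb, hb'⟩ := exists_encode_eq_clusterLabel η w
  have : a = a' := Encodable.encode_injective (by rw [ha', hb', h])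
  subst this
  exact ha.trans hb.symm

theorem openGraph_configOf_adj {A : Finset Edge} :
    (openGraph (configOf A)).Adj v w ↔ ∃ e ∈ A, e.1 = s(v, w) := by
  constructor
  · rintro ⟨h, h'⟩
    exact ⟨_, configOf_eq_true.1 h', rfl⟩
  · rintro ⟨e, he, hvw⟩
    have h : triangularLattice.Adj v w := by
      have := e.2
      rwa [hvw] at this
    refine ⟨h, configOf_eq_true.2 ?_⟩
    have : (⟨s(v, w), h⟩ : Edge) = e := Subtype.ext hvw.symm
    rwa [this]

/-- A vertex that no edge of `η` touches is connected to no other vertex. -/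
theorem eq_of_reachable_of_isolated (hB : ∀ e ∈ η, v ∉ e.1)
    (h : (openGraph (configOf η)).Reachable v w) : w = v := by
  refine mem_of_reachable (T := {v}) ?_ rfl h
  rintro a a' hadj rfl
  obtain ⟨e, he, hvw⟩ := openGraph_configOf_adj.1 hadj
  exact (hB e he (by simp [hvw])).elim

open Classical in
/-- The spins of the FK clusters of `η`: the clusters that meet `B` have spin `-1`, the others
follow their coins `τ`. -/
noncomputable def plantedSpin (η : Finset Edge) (B : Finset Vertex) (τ : ℕ → Bool) : SpinConfig :=
  fun v => if ∃ b ∈ B, (openGraph (configOf η)).Reachable b v then false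
    else τ (clusterLabel (configOf η) v)

theorem plantedSpin_empty (τ : ℕ → Bool) :
    plantedSpin η ∅ τ = (colour (configOf η, τ)).2 := by
  ext v
  simp [plantedSpin, colour]

theorem plantedSpin_of_mem (τ : ℕ → Bool) (hb : b ∈ B) : plantedSpin η B τ b = false := by
  rw [plantedSpin, if_pos ⟨b, hb, SimpleGraph.Reachable.refl b⟩]

theorem plantedSpin_anti (τ : ℕ → Bool) (h : B₁ ⊆ B₂) :
    plantedSpin η B₂ τ ≤ plantedSpin η B₁ τ := by
  intro v
  simp only [plantedSpin]
  split_ifs with h1 h2 h2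
  · exact le_rfl
  · exact Bool.false_le _
  · obtain ⟨b, hb, hbv⟩ := h2
    exact (h1 ⟨b, h hb, hbv⟩).elim
  · exact le_rfl

theorem measurable_plantedSpin : Measurable (plantedSpin η B) := by
  refine measurable_pi_lambda _ fun v => ?_
  simp only [plantedSpin]
  split_ifs
  · exact measurable_const
  · exact measurable_pi_apply _

theorem plantedSpin_insert_of_reachable (τ : ℕ → Bool)
    (h : (openGraph (configOf η)).Reachable u v) : plantedSpin η (insert u B) τ v = false :=
  if_pos ⟨u, Finset.mem_insert_self _ _, h⟩

theorem plantedSpin_insert_of_not_reachable (τ : ℕ → Bool)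
    (h : ¬ (openGraph (configOf η)).Reachable u v) :
    plantedSpin η (insert u B) τ v = plantedSpin η B τ v := by
  have : (∃ b ∈ insert u B, (openGraph (configOf η)).Reachable b v) ↔
      ∃ b ∈ B, (openGraph (configOf η)).Reachable b v := by
    simp [h]
  simp only [plantedSpin]
  by_cases h' : ∃ b ∈ B, (openGraph (configOf η)).Reachable b v
  · rw [if_pos h', if_pos (this.2 h')]
  · rw [if_neg h', if_neg fun h'' => h' (this.1 h'')]

/-- An open edge from `B` to `x` lets the spin `-1` spread to `x`. -/
theorem plantedSpin_insert (he : e.1 = s(b, x)) (hb : b ∈ B) (τ : ℕ → Bool) :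
    plantedSpin (insert e η) B τ = plantedSpin η (insert x B) τ := by
  set G := openGraph (configOf η)
  set G' := openGraph (configOf (insert e η))
  have hle : G ≤ G' := openGraph_mono fun f hf => by
    rw [configOf_eq_true] at *
    exact Finset.mem_insert_of_mem hf
  have hadj : ∀ a a', G'.Adj a a' → G.Adj a a' ∨ (a = b ∧ a' = x) ∨ (a = x ∧ a' = b) := by
    intro a a' h
    obtain ⟨f, hf, hf'⟩ := openGraph_configOf_adj.1 h
    rcases Finset.mem_insert.1 hf with rfl | hf
    · right
      rw [he] at hf'
      rcases Sym2.eq_iff.1 hf' with ⟨rfl, rfl⟩ | ⟨rfl, rfl⟩ <;> simp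
    · exact .inl (openGraph_configOf_adj.2 ⟨f, hf, hf'⟩)
  have hbx : G'.Adj b x := openGraph_configOf_adj.2 ⟨e, Finset.mem_insert_self _ _, he⟩
  have hW : ∀ v, (∃ b' ∈ B, G'.Reachable b' v) ↔ ∃ b' ∈ insert x B, G.Reachable b' v := by
    intro v
    constructor
    · rintro ⟨b', hb', h⟩
      refine mem_of_reachable (T := {v | ∃ b' ∈ insert x B, G.Reachable b' v}) ?_ ?_ h
      · rintro a a' haa ⟨b', hb', h⟩
        rcases hadj a a' haa with h1 | ⟨rfl, rfl⟩ | ⟨rfl, rfl⟩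
        · exact ⟨b', hb', h.trans h1.reachable⟩
        · exact ⟨_, Finset.mem_insert_self _ _, SimpleGraph.Reachable.refl _⟩
        · exact ⟨_, Finset.mem_insert_of_mem hb, SimpleGraph.Reachable.refl _⟩
      · exact ⟨b', Finset.mem_insert_of_mem hb', SimpleGraph.Reachable.refl _⟩
    · rintro ⟨b', hb', h⟩
      rcases Finset.mem_insert.1 hb' with rfl | hb'
      · exact ⟨b, hb, hbx.reachable.trans (h.mono hle)⟩
      · exact ⟨b', hb', h.mono hle⟩
  ext v
  simp only [plantedSpin]
  by_cases h : ∃ b' ∈ insert x B, G.Reachable b' v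
  · rw [if_pos h, if_pos ((hW v).2 h)]
  · rw [if_neg h, if_neg fun h' => h ((hW v).1 h')]
    -- Both ends of `e` lie in planted clusters, so the new edge cannot change the cluster, nor the
    -- coin, of a vertex outside them.
    have : fkCluster (configOf (insert e η)) v = fkCluster (configOf η) v := by
      refine Set.Subset.antisymm (fun a ha => ?_) fun a ha => SimpleGraph.Reachable.mono hle ha
      refine mem_of_reachable (T := fkCluster (configOf η) v) ?_ (SimpleGraph.Reachable.refl v) ha
      rintro a a' haa h1
      rcases hadj a a' haa with h2 | ⟨rfl, rfl⟩ | ⟨rfl, rfl⟩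
      · exact SimpleGraph.Reachable.trans h1 h2.reachable
      · exact (h ⟨_, Finset.mem_insert_of_mem hb, SimpleGraph.Reachable.symm h1⟩).elim
      · exact (h ⟨_, Finset.mem_insert_self _ _, SimpleGraph.Reachable.symm h1⟩).elim
    rw [clusterLabel, clusterLabel, this]

/-! ### The coins -/

/-- The law of the coins. -/
noncomputable abbrev coin (r : unitInterval) : Measure (ℕ → Bool) :=
  Measure.infinitePi fun _ : ℕ => bernoulliMeasure true false r

variable {r : unitInterval}

theorem measurable_updateCoin (i : ℕ) :
    Measurable fun q : Bool × (ℕ → Bool) => Function.update q.2 i q.1 := by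
  refine measurable_pi_lambda _ fun j => ?_
  by_cases h : j = i
  · subst h
    simpa using measurable_fst
  · simp only [Function.update_of_ne h]
    exact (measurable_pi_apply j).comp measurable_snd

/-- Tossing one coin again does not change the law of the coins. -/
theorem coin_update (i : ℕ) :
    ((bernoulliMeasure true false r).prod (coin r)).map
      (fun q : Bool × (ℕ → Bool) => Function.update q.2 i q.1) = coin r := by
  have hm := measurable_updateCoin i
  refine Measure.eq_infinitePi _ fun s t ht => ?_
  rw [Measure.map_apply hm (MeasurableSet.pi s.countable_toSet fun j _ => ht j)]
  by_cases hi : i ∈ s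
  · have : (fun q : Bool × (ℕ → Bool) => Function.update q.2 i q.1) ⁻¹' (Set.pi s t) =
        (t i) ×ˢ (Set.pi (s.erase i : Finset ℕ) t) := by
      ext ⟨a, τ⟩
      simp only [Set.mem_preimage, Set.mem_pi, Finset.mem_coe, Set.mem_prod, Finset.mem_erase]
      constructor
      · intro h
        refine ⟨by simpa using h i hi, fun j hj => by simpa [hj.1] using h j hj.2⟩
      · rintro ⟨h1, h2⟩ j hj
        by_cases hji : j = i
        · subst hji; simpa using h1
        · simpa [hji] using h2 j ⟨hji, hj⟩
    rw [this, Measure.prod_prod, Measure.infinitePi_pi _ fun j _ => ht j,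
      Finset.mul_prod_erase s (fun j => bernoulliMeasure true false r (t j)) hi]
  · have : (fun q : Bool × (ℕ → Bool) => Function.update q.2 i q.1) ⁻¹' (Set.pi s t) =
        Set.univ ×ˢ (Set.pi s t) := by
      ext ⟨a, τ⟩
      simp only [Set.mem_preimage, Set.mem_pi, Finset.mem_coe, Set.mem_prod, Set.mem_univ,
        true_and]
      refine forall₂_congr fun j hj => ?_
      have : j ≠ i := fun h => hi (h ▸ hj)
      simp [this]
    rw [this, Measure.prod_prod, Measure.infinitePi_pi _ fun j _ => ht j, measure_univ, one_mul]

/-- An event that ignores coin `i` is independent of it: toss coin `i` again and read off a product.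
-/
theorem coin_real_eq_mul {i : ℕ} {T : Set (ℕ → Bool)} (hT : MeasurableSet T)
    (hi : ∀ τ a, Function.update τ i a ∈ T ↔ τ ∈ T) :
    (coin r).real {τ | τ i = false ∧ τ ∈ T} =
      (bernoulliMeasure true false r).real {false} * (coin r).real T := by
  have hm := measurable_updateCoin i
  have hset : {τ : ℕ → Bool | τ i = false ∧ τ ∈ T} = (fun τ => τ i) ⁻¹' {false} ∩ T := by
    ext τ
    simp
  have hmeas : MeasurableSet {τ : ℕ → Bool | τ i = false ∧ τ ∈ T} := by
    rw [hset]
    exact (measurable_pi_apply i (measurableSet_singleton false)).inter hT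
  rw [← measureReal_prod_prod]
  conv_lhs => rw [← coin_update (r := r) i]
  rw [map_measureReal_apply hm hmeas]
  congr 1
  ext ⟨a, τ⟩
  simp [hi]

/-! ### Weights of spin events -/

/-- The set of spin configurations that are `-1` on `U`. -/
def minusOn (U : Finset Vertex) : Set SpinConfig := {σ | ∀ u ∈ U, σ u = false}

theorem measurableSet_minusOn (U : Finset Vertex) : MeasurableSet (minusOn U) := by
  have : minusOn U = ⋂ u ∈ U, (fun σ : SpinConfig => σ u) ⁻¹' {false} := by
    ext σ; simp [minusOn]
  rw [this]
  exact Finset.measurableSet_biInter _ fun u _ =>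
    measurable_pi_apply u (measurableSet_singleton false)

/-- The total weight of the spin event `D` when the open edges are chosen from `E` with weight `y`
each, the clusters have weight `2` each, and the clusters that meet `B` are counted as one cluster
of weight `1` and have spin `-1`. -/
noncomputable def spinWeight (y : ℝ) (r : unitInterval) (Λ : Finset Vertex) (E : Finset Edge)
    (B : Finset Vertex) (D : Set SpinConfig) : ℝ :=
  ∑ η ∈ E.powerset, y ^ η.card * (colourings Λ η B).card *
    (coin r).real {τ | plantedSpin η B τ ∈ D}

variable {y : ℝ} {D : Set SpinConfig} {U : Finset Vertex}

theorem spinWeight_univ : spinWeight y r Λ E B Set.univ =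
    ∑ η ∈ E.powerset, y ^ η.card * ((colourings Λ η B).card : ℝ) := by
  simp [spinWeight]

theorem spinWeight_nonneg (hy : 0 ≤ y) : 0 ≤ spinWeight y r Λ E B D :=
  Finset.sum_nonneg fun η _ => by positivity

theorem spinWeight_univ_pos (hy : 0 ≤ y) : 0 < spinWeight y r Λ E B Set.univ := by
  rw [spinWeight_univ]
  refine Finset.sum_pos' (fun η _ => by positivity) ⟨∅, by simp, ?_⟩
  have : 0 < (colourings Λ ∅ B).card := Finset.card_pos.2 ⟨∅, empty_mem_colourings⟩
  simp only [Finset.card_empty, pow_zero, one_mul]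
  exact_mod_cast this

theorem spinWeight_congr {D₁ D₂ : Set SpinConfig}
    (h : ∀ η ⊆ E, ∀ τ, plantedSpin η B τ ∈ D₁ ↔ plantedSpin η B τ ∈ D₂) :
    spinWeight y r Λ E B D₁ = spinWeight y r Λ E B D₂ := by
  refine Finset.sum_congr rfl fun η hη => ?_
  simp only [h η (Finset.mem_powerset.1 hη)]

/-- Deletion and contraction. Since `b` already has spin $-1$, contracting `e` is the same as
planting at `x`. -/
theorem spinWeight_insert_edge (heK : e ∉ K) (he : e.1 = s(b, x)) (hb : b ∈ B) :
    spinWeight y r Λ (insert e K) B D =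
      y * spinWeight y r Λ K (insert x B) D + spinWeight y r Λ K B D := by
  rw [spinWeight, Finset.sum_powerset_insert heK, add_comm, spinWeight, Finset.mul_sum]
  congr 1
  refine Finset.sum_congr rfl fun η hη => ?_
  have : e ∉ η := fun h => heK (Finset.mem_powerset.1 hη h)
  rw [Finset.card_insert_of_notMem this, colourings_insert he hb]
  simp only [plantedSpin_insert he hb]
  ring

/-- Comparison of averages: if the primed averages are smaller in both cases, the first case has
the smaller average, and the primed weights favour the first case, then the primed overall average
is smaller. -/
theorem mix_le {y N₁ N₂ N₁' N₂' Z₁ Z₂ Z₁' Z₂' : ℝ} (hy : 0 ≤ y) (hZ₁ : 0 < Z₁) (hZ₂ : 0 < Z₂)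
    (h₁ : N₁' * Z₁ ≤ N₁ * Z₁') (h₂ : N₂' * Z₂ ≤ N₂ * Z₂') (h₁₂ : N₁ * Z₂ ≤ N₂ * Z₁)
    (hα : Z₁ * Z₂' ≤ Z₁' * Z₂) :
    (y * N₁' + N₂') * (y * Z₁ + Z₂) ≤ (y * N₁ + N₂) * (y * Z₁' + Z₂') := by
  -- After replacing each primed numerator by its upper bound, right minus left is
  -- $(N_2/Z_2-N_1/Z_1)(Z_1'Z_2-Z_1Z_2')$, a product of two nonnegative factors.
  have cross : N₁' * Z₂ + N₂' * Z₁ ≤ N₁ * Z₂' + N₂ * Z₁' := by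
    have h3 := mul_le_mul_of_nonneg_right h₁ (sq_nonneg Z₂)
    have h4 := mul_le_mul_of_nonneg_right h₂ (sq_nonneg Z₁)
    have h5 := mul_nonneg (sub_nonneg.2 hα) (sub_nonneg.2 h₁₂)
    refine le_of_mul_le_mul_right ?_ (mul_pos hZ₁ hZ₂)
    nlinarith
  nlinarith [mul_le_mul_of_nonneg_left cross hy, mul_le_mul_of_nonneg_left h₁ (mul_nonneg hy hy)]

theorem spinWeight_univ_mul_le (hy : 0 ≤ y) (E₁ E₂ : Finset Edge) (B₁ B₂ : Finset Vertex) :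
    spinWeight y r Λ E₁ B₁ Set.univ * spinWeight y r Λ E₂ B₂ Set.univ ≤
      spinWeight y r Λ (E₁ ∩ E₂) (B₁ ∩ B₂) Set.univ *
        spinWeight y r Λ (E₁ ∪ E₂) (B₁ ∪ B₂) Set.univ := by
  simpa [spinWeight_univ] using sum_mul_sum_le (Λ := Λ) hy (fun _ => True) (fun _ _ _ h => h)
    E₁ E₂ B₁ B₂

/-- The dichotomy behind the inductions: either an edge at the planted set can be revealed, or the
planted set is cut off from all edges. -/
theorem exists_edge_or_isolated (E : Finset Edge) (B : Finset Vertex) :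
    (∃ e ∈ E, ∃ b ∈ B, ∃ x, e.1 = s(b, x)) ∨ ∀ e ∈ E, ∀ v ∈ e.1, v ∉ B := by
  by_cases h : ∀ e ∈ E, ∀ v ∈ e.1, v ∉ B
  · exact .inr h
  · push Not at h
    obtain ⟨e, he, v, hv, hvB⟩ := h
    obtain ⟨x, hx⟩ := Sym2.mem_iff_exists.1 hv
    exact .inl ⟨e, he, v, hvB, x, hx⟩

/-! ### Planting and conditioning on minus spins -/

/-- Planting a spin `-1` at one more vertex makes increasing events less likely. -/
theorem spinWeight_plant_le (hy : 0 ≤ y) (hD : IsUpperSet D) (hE : ∀ e ∈ E, ∀ v ∈ e.1, v ∈ Λ)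
    (hw : w ∈ Λ) :
    spinWeight y r Λ E (insert w B) D * spinWeight y r Λ E B Set.univ ≤
      spinWeight y r Λ E B D * spinWeight y r Λ E (insert w B) Set.univ := by
  induction E using Finset.strongInduction generalizing B w with
  | H E ih =>
  by_cases hwB : w ∈ B
  · rw [Finset.insert_eq_of_mem hwB]
  rcases exists_edge_or_isolated E B with ⟨e, he, b, hb, x, hx⟩ | hiso
  · have hK := Finset.erase_ssubset he
    have heK := Finset.notMem_erase e E
    have hEK : ∀ f ∈ E.erase e, ∀ v ∈ f.1, v ∈ Λ := fun f hf => hE f (Finset.mem_of_mem_erase hf)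
    have hxΛ : x ∈ Λ := hE e he x (by simp [hx])
    rw [← Finset.insert_erase he]
    simp only [spinWeight_insert_edge heK hx hb,
      spinWeight_insert_edge heK hx (Finset.mem_insert_of_mem hb)]
    -- The first outcome is `e` open, which plants `x`; the second is `e` closed. That the first has
    -- the smaller average is again the induction hypothesis, now for planting `x`.
    refine mix_le hy (spinWeight_univ_pos hy) (spinWeight_univ_pos hy) ?_ (ih _ hK hEK hw)
      (ih _ hK hEK hxΛ) ?_
    · rw [Finset.insert_comm]
      exact ih _ hK hEK hw
    · rcases eq_or_ne x w with rfl | hxw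
      · rw [Finset.insert_eq_of_mem (Finset.mem_insert_self x B)]
        refine mul_le_mul_of_nonneg_left ?_ (spinWeight_nonneg hy)
        simp only [spinWeight_univ]
        refine Finset.sum_le_sum fun η _ => mul_le_mul_of_nonneg_left ?_ (by positivity)
        exact_mod_cast Finset.card_le_card
          (colourings_anti Finset.Subset.rfl (Finset.subset_insert _ _))
      · have := spinWeight_univ_mul_le (Λ := Λ) (r := r) hy (E.erase e) (E.erase e)
          (insert x B) (insert w B)
        have h1 : insert x B ∩ insert w B = B := by
          ext a; simp only [Finset.mem_inter, Finset.mem_insert]; grind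
        have h2 : insert x B ∪ insert w B = insert x (insert w B) := by
          ext a; simp only [Finset.mem_union, Finset.mem_insert]; tauto
        rw [Finset.inter_self, Finset.union_self, h1, h2] at this
        linarith
  · have h2 : ∀ η ∈ E.powerset, ((colourings Λ η B).card : ℝ) =
        2 * (colourings Λ η (insert w B)).card := by
      intro η hη
      have hη := Finset.mem_powerset.1 hη
      exact_mod_cast card_colourings_eq_two_mul (fun e he => hE e (hη he))
        (fun e he => hiso e (hη he)) hw hwB
    have h3 : spinWeight y r Λ E B Set.univ = 2 * spinWeight y r Λ E (insert w B) Set.univ := by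
      rw [spinWeight_univ, spinWeight_univ, Finset.mul_sum]
      refine Finset.sum_congr rfl fun η hη => ?_
      rw [h2 η hη]; ring
    have h4 : 2 * spinWeight y r Λ E (insert w B) D ≤ spinWeight y r Λ E B D := by
      rw [spinWeight, spinWeight, Finset.mul_sum]
      refine Finset.sum_le_sum fun η hη => ?_
      rw [h2 η hη]
      have : (coin r).real {τ | plantedSpin η (insert w B) τ ∈ D} ≤
          (coin r).real {τ | plantedSpin η B τ ∈ D} :=
        measureReal_mono fun τ h => hD (plantedSpin_anti τ (Finset.subset_insert _ _)) h
      have h5 := mul_le_mul_of_nonneg_left this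
        (show 0 ≤ y ^ η.card * (2 * ((colourings Λ η (insert w B)).card : ℝ)) by positivity)
      linarith
    rw [h3]
    have := mul_le_mul_of_nonneg_right h4
      (spinWeight_nonneg (r := r) (Λ := Λ) (E := E) (B := insert w B) (D := Set.univ) hy)
    linarith

/-- The cluster of `u` avoids `B`, so it carries a factor 2 and a coin of its own. Minus at `u`
fixes this coin, at cost $1-r$, and the spins are then those with `u` planted, which no longer
depend on the coin. -/
theorem spinWeight_minus_of_isolated (hE : ∀ e ∈ E, ∀ v ∈ e.1, v ∈ Λ) (hD : MeasurableSet D)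
    (hiso : ∀ e ∈ E, ∀ v ∈ e.1, v ∉ B) (huΛ : u ∈ Λ) (hu : u ∈ U) (huB : u ∉ B) :
    spinWeight y r Λ E B (D ∩ minusOn U) = 2 * (bernoulliMeasure true false r).real {false} *
      spinWeight y r Λ E (insert u B) (D ∩ minusOn U) := by
  rw [spinWeight, spinWeight, Finset.mul_sum]
  refine Finset.sum_congr rfl fun η hη => ?_
  have hη := Finset.mem_powerset.1 hη
  have h1 : ((colourings Λ η B).card : ℝ) = 2 * (colourings Λ η (insert u B)).card := by
    exact_mod_cast card_colourings_eq_two_mul (fun e he => hE e (hη he))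
      (fun e he => hiso e (hη he)) huΛ huB
  set i := clusterLabel (configOf η) u with hi
  set T := {τ | plantedSpin η (insert u B) τ ∈ D ∩ minusOn U} with hT
  have hnr : ∀ b ∈ B, ¬ (openGraph (configOf η)).Reachable b u := by
    intro b hb h
    have := eq_of_reachable_of_isolated (fun e he h' => hiso e (hη he) b h' hb) h
    exact huB (this ▸ hb)
  have h2 : {τ | plantedSpin η B τ ∈ D ∩ minusOn U} = {τ | τ i = false ∧ τ ∈ T} := by
    have h3 : ∀ τ : ℕ → Bool, τ i = false → plantedSpin η B τ = plantedSpin η (insert u B) τ := by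
      intro τ hτ
      ext v
      by_cases hv : (openGraph (configOf η)).Reachable u v
      · have : clusterLabel (configOf η) v = i := (clusterLabel_congr hv).symm
        rw [plantedSpin_insert_of_reachable τ hv, plantedSpin, this, hτ, ite_self]
      · rw [plantedSpin_insert_of_not_reachable τ hv]
    ext τ
    simp only [Set.mem_ofPred_eq, hT]
    constructor
    · intro h
      have h4 : τ i = false := by
        have := h.2 u hu
        simp only [plantedSpin] at this
        rwa [if_neg (by push Not; exact hnr)] at this
      exact ⟨h4, by rwa [← h3 τ h4]⟩
    · rintro ⟨h4, h5⟩
      rwa [h3 τ h4]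
  rw [h1, h2, coin_real_eq_mul]
  · ring
  · exact measurable_plantedSpin (hD.inter (measurableSet_minusOn U))
  · intro τ a
    have : plantedSpin η (insert u B) (Function.update τ i a) = plantedSpin η (insert u B) τ := by
      ext v
      by_cases hv : (openGraph (configOf η)).Reachable u v
      · rw [plantedSpin_insert_of_reachable _ hv, plantedSpin_insert_of_reachable _ hv]
      · have : clusterLabel (configOf η) v ≠ i := fun h =>
          hv (reachable_of_clusterLabel_eq h.symm)
        rw [plantedSpin_insert_of_not_reachable _ hv, plantedSpin_insert_of_not_reachable _ hv]
        simp only [plantedSpin, Function.update_of_ne this]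
    simp only [hT, Set.mem_ofPred_eq, this]

end TriFK

namespace TriFK

variable {Λ B B₁ B₂ : Finset Vertex} {η η₁ η₂ K E E₁ E₂ : Finset Edge} {e : Edge} {b u v w x : Vertex}
  {c : Finset Vertex} {r : unitInterval} {y : ℝ} {D : Set SpinConfig} {U : Finset Vertex}

/-! ### The comparison in finite volume -/

theorem spinWeight_add_compl (hD : MeasurableSet D) :
    spinWeight y r Λ E B D + spinWeight y r Λ E B Dᶜ = spinWeight y r Λ E B Set.univ := by
  simp only [spinWeight]
  rw [← Finset.sum_add_distrib]
  refine Finset.sum_congr rfl fun η _ => ?_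
  rw [← mul_add]
  have h := measureReal_add_measureReal_compl (μ := coin r)
    (measurable_plantedSpin (η := η) (B := B) hD)
  have h' : {τ | plantedSpin η B τ ∈ Set.univ} = Set.univ := Set.eq_univ_of_forall fun _ => trivial
  rw [h']
  exact congrArg _ h

theorem plantedSpin_mem_minusOn (h : U ⊆ B) (τ : ℕ → Bool) : plantedSpin η B τ ∈ minusOn U :=
  fun _ hu => plantedSpin_of_mem τ (h hu)

theorem isUpperSet_compl_minusOn (U : Finset Vertex) : IsUpperSet (minusOn U)ᶜ := by
  rw [isUpperSet_compl]
  intro σ σ' h hσ u hu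
  have h1 := h u
  rw [hσ u hu] at h1
  exact Bool.eq_false_of_le_false h1

/-- Given that the spins on `U` are `-1`, increasing events become less likely than after
the removal of edges that touch `U` or `B`. -/
theorem spinWeight_minus_mul_le (hy : 0 ≤ y) (hD : IsUpperSet D) (hDm : MeasurableSet D)
    (hE : ∀ e ∈ E, ∀ v ∈ e.1, v ∈ Λ) (hU : U ⊆ Λ) {E' : Finset Edge} (hE' : E' ⊆ E)
    (hEE' : ∀ e ∈ E, e ∉ E' → ∃ v ∈ e.1, v ∈ U ∨ v ∈ B) :
    spinWeight y r Λ E B (D ∩ minusOn U) * spinWeight y r Λ E' B Set.univ ≤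
      spinWeight y r Λ E' B D * spinWeight y r Λ E B (minusOn U) := by
  classical
  -- Revealing an edge shrinks `E` and never enlarges `U \ B`; planting a vertex of `U` shrinks `U \
  -- B`.
  induction hn : E.card + (U \ B).card using Nat.strong_induction_on generalizing E E' B with
  | _ n ih =>
  rcases exists_edge_or_isolated E B with ⟨e, he, b, hb, x, hx⟩ | hiso
  · have heK := Finset.notMem_erase e E
    have hEK : ∀ f ∈ E.erase e, ∀ v ∈ f.1, v ∈ Λ := fun f hf => hE f (Finset.mem_of_mem_erase hf)
    have hxΛ : x ∈ Λ := hE e he x (by simp [hx])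
    have hcard := Finset.card_erase_lt_of_mem he
    have hcard' : (U \ insert x B).card ≤ (U \ B).card :=
      Finset.card_le_card (Finset.sdiff_subset_sdiff Finset.Subset.rfl (Finset.subset_insert _ _))
    by_cases heE' : e ∈ E'
    · have heK' := Finset.notMem_erase e E'
      have hK' : E'.erase e ⊆ E.erase e := Finset.erase_subset_erase e hE'
      have hKK' : ∀ f ∈ E.erase e, f ∉ E'.erase e → ∃ v ∈ f.1, v ∈ U ∨ v ∈ B := by
        intro f hf hf'
        rw [Finset.mem_erase] at hf hf'
        exact hEE' f hf.2 fun h => hf' ⟨hf.1, h⟩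
      have hKKx : ∀ f ∈ E.erase e, f ∉ E'.erase e → ∃ v ∈ f.1, v ∈ U ∨ v ∈ insert x B := by
        intro f hf hf'
        obtain ⟨v, hv, h⟩ := hKK' f hf hf'
        exact ⟨v, hv, h.imp_right (Finset.mem_insert_of_mem ·)⟩
      have hE'K : ∀ f ∈ E'.erase e, ∀ v ∈ f.1, v ∈ Λ := fun f hf => hEK f (hK' hf)
      rw [← Finset.insert_erase he, ← Finset.insert_erase heE']
      simp only [spinWeight_insert_edge heK hx hb, spinWeight_insert_edge heK' hx hb]
      refine mix_le hy (spinWeight_univ_pos hy) (spinWeight_univ_pos hy)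
        (ih _ (by omega) hEK hK' hKKx rfl) (ih _ (by omega) hEK hK' hKK' rfl)
        (spinWeight_plant_le hy hD hE'K hxΛ) ?_
      -- The conditioned model must favour `e` open. Passing to complements, planting `x` makes
      -- minus on `U` more likely (`h5`), and by the lattice inequality more available edges also
      -- favour an open `e` (`h4`).
      have h1 := spinWeight_plant_le (r := r) (B := B) hy (isUpperSet_compl_minusOn U) hEK hxΛ
      have h2 := spinWeight_add_compl (y := y) (r := r) (Λ := Λ) (E := E.erase e) (B := B)
        (measurableSet_minusOn U)
      have h3 := spinWeight_add_compl (y := y) (r := r) (Λ := Λ) (E := E.erase e) (B := insert x B)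
        (measurableSet_minusOn U)
      have h4 := spinWeight_univ_mul_le (Λ := Λ) (r := r) hy (E'.erase e) (E.erase e)
        (insert x B) B
      rw [Finset.inter_eq_left.2 hK', Finset.union_eq_right.2 hK',
        Finset.inter_eq_right.2 (Finset.subset_insert _ _),
        Finset.union_eq_left.2 (Finset.subset_insert _ _)] at h4
      have p1 := spinWeight_univ_pos (r := r) (Λ := Λ) (E := E.erase e) (B := B) hy
      have p2 := spinWeight_univ_pos (r := r) (Λ := Λ) (E := E'.erase e) (B := B) hy
      have p3 := spinWeight_nonneg (r := r) (Λ := Λ) (E := E.erase e) (B := B)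
        (D := minusOn U) hy
      rw [← sub_eq_iff_eq_add'.2 h2.symm, ← sub_eq_iff_eq_add'.2 h3.symm] at h1
      have h5 : spinWeight y r Λ (E.erase e) B (minusOn U) *
          spinWeight y r Λ (E.erase e) (insert x B) Set.univ ≤
          spinWeight y r Λ (E.erase e) (insert x B) (minusOn U) *
          spinWeight y r Λ (E.erase e) B Set.univ := by linarith
      refine le_of_mul_le_mul_right ?_ p1
      have h6 := mul_le_mul_of_nonneg_left h4 p3
      have h7 := mul_le_mul_of_nonneg_left h5 p2.le
      linarith
    · have hK' : E' ⊆ E.erase e := Finset.subset_erase.2 ⟨hE', heE'⟩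
      have hKK' : ∀ f ∈ E.erase e, f ∉ E' → ∃ v ∈ f.1, v ∈ U ∨ v ∈ B := fun f hf hf' =>
        hEE' f (Finset.mem_of_mem_erase hf) hf'
      have hKKx : ∀ f ∈ E.erase e, f ∉ E' → ∃ v ∈ f.1, v ∈ U ∨ v ∈ insert x B := by
        intro f hf hf'
        obtain ⟨v, hv, h⟩ := hKK' f hf hf'
        exact ⟨v, hv, h.imp_right (Finset.mem_insert_of_mem ·)⟩
      -- Only the larger model contains `e`. If `e` is open there, the induction hypothesis compares
      -- with `E'` planted at `x` as well, and `h3` removes that planting.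
      rw [← Finset.insert_erase he]
      simp only [spinWeight_insert_edge heK hx hb]
      have h1 := ih _ (by omega) hEK hK' hKKx rfl
      have h2 := ih _ (by omega) hEK hK' hKK' rfl
      have h3 := spinWeight_plant_le (r := r) (B := B) (D := D) hy hD
        (fun f hf => hEK f (hK' hf)) hxΛ
      have p1 := spinWeight_univ_pos (r := r) (Λ := Λ) (E := E') (B := insert x B) hy
      have p2 := spinWeight_univ_pos (r := r) (Λ := Λ) (E := E') (B := B) hy
      have p3 := spinWeight_nonneg (r := r) (Λ := Λ) (E := E.erase e) (B := insert x B)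
        (D := minusOn U) hy
      have h4 : spinWeight y r Λ (E.erase e) (insert x B) (D ∩ minusOn U) *
          spinWeight y r Λ E' B Set.univ ≤ spinWeight y r Λ E' B D *
          spinWeight y r Λ (E.erase e) (insert x B) (minusOn U) := by
        refine le_of_mul_le_mul_right ?_ p1
        have h5 := mul_le_mul_of_nonneg_right h1 p2.le
        have h6 := mul_le_mul_of_nonneg_right h3 p3
        linarith
      have h5 := mul_le_mul_of_nonneg_left h4 hy
      linarith
  · by_cases hUB : U ⊆ B
    · have : E' = E := by
        refine Finset.Subset.antisymm hE' fun e he => ?_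
        by_contra h
        obtain ⟨v, hv, h1 | h1⟩ := hEE' e he h
        · exact hiso e he v hv (hUB h1)
        · exact hiso e he v hv h1
      subst this
      rw [spinWeight_congr (D₁ := D ∩ minusOn U) (D₂ := D), spinWeight_congr (D₁ := minusOn U)
        (D₂ := Set.univ)]
      · intro η _ τ
        simpa using plantedSpin_mem_minusOn hUB τ
      · intro η _ τ
        simpa using fun _ => plantedSpin_mem_minusOn hUB τ
    · obtain ⟨u, hu, huB⟩ := Finset.not_subset.1 hUB
      have huΛ := hU hu
      have hcard : (U \ insert u B).card < (U \ B).card := by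
        refine Finset.card_lt_card ⟨Finset.sdiff_subset_sdiff Finset.Subset.rfl
          (Finset.subset_insert _ _), fun h => ?_⟩
        have := h (Finset.mem_sdiff.2 ⟨hu, huB⟩)
        simp at this
      have h1 := ih _ (by omega) (B := insert u B) hE hE' (fun e he he' => by
        obtain ⟨v, hv, h⟩ := hEE' e he he'
        exact ⟨v, hv, h.imp_right (Finset.mem_insert_of_mem ·)⟩) rfl
      have h2 := spinWeight_plant_le (r := r) (B := B) (D := D) hy hD
        (fun f hf => hE f (hE' hf)) huΛ
      have h3 := spinWeight_minus_of_isolated (y := y) (r := r) hE MeasurableSet.univ hiso huΛ hu huB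
      rw [Set.univ_inter] at h3
      -- The factor $2(1-r)$ appears with `D` and with the whole space, so it is harmless.
      -- Conditioning at `u` has become planting, which `h2` undoes in the smaller model.
      rw [spinWeight_minus_of_isolated hE hDm hiso huΛ hu huB, h3]
      have p1 := spinWeight_univ_pos (r := r) (Λ := Λ) (E := E') (B := insert u B) hy
      have p2 := spinWeight_univ_pos (r := r) (Λ := Λ) (E := E') (B := B) hy
      have p3 := spinWeight_nonneg (r := r) (Λ := Λ) (E := E) (B := insert u B)
        (D := minusOn U) hy
      have h4 : spinWeight y r Λ E (insert u B) (D ∩ minusOn U) *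
          spinWeight y r Λ E' B Set.univ ≤ spinWeight y r Λ E' B D *
          spinWeight y r Λ E (insert u B) (minusOn U) := by
        refine le_of_mul_le_mul_right ?_ p1
        have h5 := mul_le_mul_of_nonneg_right h1 p2.le
        have h6 := mul_le_mul_of_nonneg_right h2 p3
        linarith
      have h5 := mul_le_mul_of_nonneg_left h4 (show 0 ≤ 2 * (bernoulliMeasure true false r).real {false} by positivity)
      linarith

/-! ### Independence of the inside and the outside -/

open Classical in
/-- If no edge of `E` joins `U` to its complement, then conditioning on minus spins on `U` gives the
same law as removing the edges inside `U` and planting minus spins on `U`. -/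
theorem exists_spinWeight_minus_eq (hE : ∀ e ∈ E, ∀ v ∈ e.1, v ∈ Λ) (hU : U ⊆ Λ) (hBU : B ⊆ U)
    (hEU : ∀ e ∈ E, (∀ v ∈ e.1, v ∈ U) ∨ ∀ v ∈ e.1, v ∉ U) :
    ∃ κ : ℝ, ∀ D, MeasurableSet D → spinWeight y r Λ E B (D ∩ minusOn U) =
      κ * spinWeight y r Λ {e ∈ E | ∀ v ∈ e.1, v ∉ U} U D := by
  induction hn : E.card + (U \ B).card using Nat.strong_induction_on generalizing E B with
  | _ n ih =>
  rcases exists_edge_or_isolated E B with ⟨e, he, b, hb, x, hx⟩ | hiso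
  · have heK := Finset.notMem_erase e E
    have hbe : b ∈ e.1 := by simp [hx]
    have heU : ∀ v ∈ e.1, v ∈ U := (hEU e he).resolve_right fun h => h b hbe (hBU hb)
    have hxU : x ∈ U := heU x (by simp [hx])
    have hcard := Finset.card_erase_lt_of_mem he
    have hcard' : (U \ insert x B).card ≤ (U \ B).card :=
      Finset.card_le_card (Finset.sdiff_subset_sdiff Finset.Subset.rfl (Finset.subset_insert _ _))
    -- The revealed edge lies inside `U`, hence is not among the outside edges: revealing it affects
    -- only the constant.
    have hK : {f ∈ E.erase e | ∀ v ∈ f.1, v ∉ U} = {f ∈ E | ∀ v ∈ f.1, v ∉ U} := by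
      ext f
      simp only [Finset.mem_filter, Finset.mem_erase]
      refine ⟨fun h => ⟨h.1.2, h.2⟩, fun h => ⟨⟨?_, h.1⟩, h.2⟩⟩
      rintro rfl
      exact h.2 b hbe (hBU hb)
    obtain ⟨κ₁, h₁⟩ := ih _ (by omega) (E := E.erase e) (B := insert x B)
      (fun f hf => hE f (Finset.mem_of_mem_erase hf)) (Finset.insert_subset hxU hBU)
      (fun f hf => hEU f (Finset.mem_of_mem_erase hf)) rfl
    obtain ⟨κ₂, h₂⟩ := ih _ (by omega) (E := E.erase e) (B := B)
      (fun f hf => hE f (Finset.mem_of_mem_erase hf)) hBU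
      (fun f hf => hEU f (Finset.mem_of_mem_erase hf)) rfl
    refine ⟨y * κ₁ + κ₂, fun D hD => ?_⟩
    conv_lhs => rw [← Finset.insert_erase he]
    rw [spinWeight_insert_edge heK hx hb, h₁ D hD, h₂ D hD, hK]
    ring
  · by_cases hUB : U ⊆ B
    · obtain rfl : B = U := Finset.Subset.antisymm hBU hUB
      refine ⟨1, fun D _ => ?_⟩
      rw [Finset.filter_true_of_mem hiso, one_mul]
      refine spinWeight_congr fun η _ τ => ?_
      simpa using fun _ => plantedSpin_mem_minusOn hUB τ
    · obtain ⟨u, hu, huB⟩ := Finset.not_subset.1 hUB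
      have hcard : (U \ insert u B).card < (U \ B).card := by
        refine Finset.card_lt_card ⟨Finset.sdiff_subset_sdiff Finset.Subset.rfl
          (Finset.subset_insert _ _), fun h => ?_⟩
        have := h (Finset.mem_sdiff.2 ⟨hu, huB⟩)
        simp at this
      obtain ⟨κ, h⟩ := ih _ (by omega) (B := insert u B) hE (Finset.insert_subset hu hBU) hEU rfl
      refine ⟨2 * (bernoulliMeasure true false r).real {false} * κ, fun D hD => ?_⟩
      rw [spinWeight_minus_of_isolated hE hD hiso (hU hu) hu huB, h D hD]
      ring

/-- The configuration that is `-1` on `U` and agrees with `σ` elsewhere. -/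
def setMinus (U : Finset Vertex) (σ : SpinConfig) : SpinConfig :=
  fun v => if v ∈ U then false else σ v

theorem setMinus_of_mem_minusOn {σ : SpinConfig} (h : σ ∈ minusOn U) : setMinus U σ = σ := by
  ext v
  by_cases hv : v ∈ U
  · simp [setMinus, hv, h v hv]
  · simp [setMinus, hv]

theorem monotone_setMinus : Monotone (setMinus U) := by
  intro σ σ' h v
  by_cases hv : v ∈ U
  · simp [setMinus, hv]
  · simpa [setMinus, hv] using h v

theorem measurable_setMinus : Measurable (setMinus U) := by
  refine measurable_pi_lambda _ fun v => ?_
  by_cases hv : v ∈ U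
  · simp [setMinus, hv]
  · simpa [setMinus, hv] using measurable_pi_apply v

/-- The vertices of `U` are singleton clusters and `setMinus` erases their spins, so planting each
further one only removes a factor 2. -/
theorem exists_spinWeight_setMinus_eq (hE : ∀ e ∈ E, ∀ v ∈ e.1, v ∈ Λ) (hU : U ⊆ Λ) (hBU : B ⊆ U)
    (hEU : ∀ e ∈ E, ∀ v ∈ e.1, v ∉ U) :
    ∃ κ : ℝ, ∀ D, spinWeight y r Λ E B (setMinus U ⁻¹' D) = κ * spinWeight y r Λ E U D := by
  induction hn : (U \ B).card using Nat.strong_induction_on generalizing B with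
  | _ n ih =>
  by_cases hUB : U ⊆ B
  · obtain rfl : B = U := Finset.Subset.antisymm hBU hUB
    refine ⟨1, fun D => ?_⟩
    rw [one_mul]
    refine spinWeight_congr fun η _ τ => ?_
    rw [Set.mem_preimage, setMinus_of_mem_minusOn fun u hu => plantedSpin_of_mem τ hu]
  · obtain ⟨u, hu, huB⟩ := Finset.not_subset.1 hUB
    have hcard : (U \ insert u B).card < (U \ B).card := by
      refine Finset.card_lt_card ⟨Finset.sdiff_subset_sdiff Finset.Subset.rfl
        (Finset.subset_insert _ _), fun h => ?_⟩
      have := h (Finset.mem_sdiff.2 ⟨hu, huB⟩)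
      simp at this
    obtain ⟨κ, h⟩ := ih _ (by omega) (B := insert u B) (Finset.insert_subset hu hBU) rfl
    refine ⟨2 * κ, fun D => ?_⟩
    rw [mul_assoc, ← h D, spinWeight, spinWeight, Finset.mul_sum]
    refine Finset.sum_congr rfl fun η hη => ?_
    have hη := Finset.mem_powerset.1 hη
    have h1 : ((colourings Λ η B).card : ℝ) = 2 * (colourings Λ η (insert u B)).card := by
      exact_mod_cast card_colourings_eq_two_mul (fun e he => hE e (hη he))
        (fun e he v hv hvB => hEU e (hη he) v hv (hBU hvB)) (hU hu) huB
    have h2 : ∀ τ, setMinus U (plantedSpin η B τ) = setMinus U (plantedSpin η (insert u B) τ) := by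
      intro τ
      ext v
      by_cases hv : v ∈ U
      · simp [setMinus, hv]
      · have : ¬ (openGraph (configOf η)).Reachable u v := by
          intro h
          have := eq_of_reachable_of_isolated (fun e he h' => hEU e (hη he) u h' hu) h
          exact hv (this ▸ hu)
        simp only [setMinus, hv, if_false]
        rw [plantedSpin_insert_of_not_reachable τ this]
    simp only [Set.mem_preimage, h2, h1]
    ring

open Classical in
/-- Given minus spins on `U`, closing the edges between `U` and its complement makes increasing
events more likely. -/
theorem spinWeight_minus_mul_minus_le (hy : 0 ≤ y) (hD : IsUpperSet D) (hDm : MeasurableSet D)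
    (hE : ∀ e ∈ E, ∀ v ∈ e.1, v ∈ Λ) (hU : U ⊆ Λ) {E' : Finset Edge} (hE' : E' ⊆ E)
    (hEE' : ∀ e ∈ E, e ∉ E' → ∃ v ∈ e.1, v ∈ U)
    (hEU : ∀ e ∈ E', (∀ v ∈ e.1, v ∈ U) ∨ ∀ v ∈ e.1, v ∉ U) :
    spinWeight y r Λ E ∅ (D ∩ minusOn U) * spinWeight y r Λ E' ∅ (minusOn U) ≤
      spinWeight y r Λ E' ∅ (D ∩ minusOn U) * spinWeight y r Λ E ∅ (minusOn U) := by
  -- The edges inside `U` are dropped too. The model on `E'` given minus on `U` and the model on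
  -- `E₀` seen through `setMinus` are then both proportional to `E₀` with `U` planted.
  set E₀ := {e ∈ E' | ∀ v ∈ e.1, v ∉ U} with hE₀
  have hE₀E : E₀ ⊆ E := (Finset.filter_subset _ _).trans hE'
  obtain ⟨κ, hκ⟩ := exists_spinWeight_minus_eq (y := y) (r := r) (fun e he => hE e (hE' he)) hU
    (Finset.empty_subset U) hEU
  obtain ⟨κ', hκ'⟩ := exists_spinWeight_setMinus_eq (y := y) (r := r) (E := E₀)
    (fun e he => hE e (hE₀E he)) hU (Finset.empty_subset U)
    (fun e he => (Finset.mem_filter.1 he).2)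
  have h1 := spinWeight_minus_mul_le (r := r) (B := ∅) (D := setMinus U ⁻¹' D) hy
    (hD.preimage monotone_setMinus) (measurable_setMinus hDm) hE hU hE₀E (fun e he he' => by
      by_cases h : e ∈ E'
      · rw [hE₀, Finset.mem_filter] at he'
        push Not at he'
        obtain ⟨v, hv, hvU⟩ := he' h
        exact ⟨v, hv, .inl hvU⟩
      · obtain ⟨v, hv, hvU⟩ := hEE' e he h
        exact ⟨v, hv, .inl hvU⟩)
  rw [spinWeight_congr (D₁ := setMinus U ⁻¹' D ∩ minusOn U) (D₂ := D ∩ minusOn U), hκ' D] at h1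
  swap
  · intro η _ τ
    simp only [Set.mem_inter_iff, Set.mem_preimage]
    exact and_congr_left fun h => by rw [setMinus_of_mem_minusOn h]
  have h2 := hκ' Set.univ
  rw [Set.preimage_univ] at h2
  have h3 := hκ Set.univ MeasurableSet.univ
  rw [Set.univ_inter] at h3
  rw [h2] at h1
  rw [h3, hκ D hDm]
  have p1 := spinWeight_univ_pos (r := r) (Λ := Λ) (E := E₀) (B := ∅) hy
  have p2 := spinWeight_univ_pos (r := r) (Λ := Λ) (E := E₀) (B := U) hy
  have p3 := spinWeight_nonneg (r := r) (Λ := Λ) (E := E') (B := ∅) (D := minusOn U) hy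
  rw [h2] at p1
  rw [h3] at p3
  have hκ'pos : 0 < κ' := pos_of_mul_pos_left p1 p2.le
  have hκpos : 0 ≤ κ := nonneg_of_mul_nonneg_left p3 p2
  have h4 : spinWeight y r Λ E ∅ (D ∩ minusOn U) * spinWeight y r Λ E₀ U Set.univ ≤
      spinWeight y r Λ E₀ U D * spinWeight y r Λ E ∅ (minusOn U) := by
    refine le_of_mul_le_mul_left ?_ hκ'pos
    linarith
  have h5 := mul_le_mul_of_nonneg_left h4 hκpos
  linarith

end TriFK

namespace TriFK

/-! ### The random-cluster measures of the boxes -/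

theorem mem_edgesIn {Λ : Finset Vertex} {e : Edge} : e ∈ edgesIn Λ ↔ ∀ v ∈ e.1, v ∈ Λ := by
  simp [edgesIn, Finset.mem_sym2_iff]

/-- A colouring constant on clusters is the choice of a set of clusters meeting `Λ`. -/
theorem two_pow_numClusters {Λ : Finset Vertex} {A : Finset Edge} (hA : A ⊆ edgesIn Λ) :
    2 ^ numClusters Λ (configOf A) = (colourings Λ A ∅).card := by
  classical
  set mk := (openGraph (configOf A)).connectedComponentMk
  have h1 : numClusters Λ (configOf A) = (Λ.image mk).card := by
    rw [numClusters, ← Finset.coe_image, Set.ncard_coe_finset]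
  rw [h1, ← Finset.card_powerset]
  have hmk : ∀ c ∈ colourings Λ A ∅, ∀ v w, mk v = mk w → v ∈ c → w ∈ c := by
    intro c hc v w h hv
    rw [mem_colourings] at hc
    refine mem_of_reachable (T := (c : Set Vertex)) ?_ hv (SimpleGraph.ConnectedComponent.eq.1 h)
    intro a a' haa ha
    obtain ⟨e, he, hee⟩ := openGraph_configOf_adj.1 haa
    exact ((agrees_iff hee).1 (hc.2.1 e he)).1 ha
  refine Finset.card_nbij' 
    (fun t : Finset (openGraph (configOf A)).ConnectedComponent => {v ∈ Λ | mk v ∈ t})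
    (fun c : Finset Vertex => c.image mk) ?_ ?_ ?_ ?_
  · intro t _
    rw [Finset.mem_coe, mem_colourings]
    refine ⟨Finset.filter_subset _ _, fun e he => ?_, by simp⟩
    obtain ⟨v, w, hvw, -⟩ := exists_ends e
    have hv : v ∈ Λ := mem_edgesIn.1 (hA he) v (by simp [hvw])
    have hw : w ∈ Λ := mem_edgesIn.1 (hA he) w (by simp [hvw])
    have : mk v = mk w := SimpleGraph.ConnectedComponent.eq.2
      (openGraph_configOf_adj.2 ⟨e, he, hvw⟩).reachable
    rw [agrees_iff hvw]
    simp [hv, hw, this]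
  · intro c hc
    rw [Finset.mem_coe, mem_colourings] at hc
    exact Finset.mem_coe.2 (Finset.mem_powerset.2 (Finset.image_subset_image hc.1))
  · intro t ht
    have ht := Finset.mem_powerset.1 ht
    ext a
    simp only [Finset.mem_image, Finset.mem_filter]
    constructor
    · rintro ⟨v, ⟨-, h⟩, rfl⟩
      exact h
    · intro ha
      obtain ⟨v, hv, rfl⟩ := Finset.mem_image.1 (ht ha)
      exact ⟨v, ⟨hv, ha⟩, rfl⟩
  · intro c hc
    ext v
    simp only [Finset.mem_image, Finset.mem_filter]
    constructor
    · rintro ⟨-, w, hw, h⟩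
      exact hmk c hc w v h hw
    · intro hv
      exact ⟨(mem_colourings.1 hc).1 hv, v, hv, rfl⟩

/-- No edge of `A` touches the extra vertices, so they are coloured freely. -/
theorem card_colourings_of_subset {Λ Λ' : Finset Vertex} {A : Finset Edge} (hΛ : Λ ⊆ Λ')
    (hA : A ⊆ edgesIn Λ) :
    (colourings Λ' A ∅).card = 2 ^ (Λ' \ Λ).card * (colourings Λ A ∅).card := by
  classical
  rw [← Finset.card_powerset, ← Finset.card_product]
  have key : ∀ c c' : Finset Vertex, (∀ v ∈ Λ, v ∈ c ↔ v ∈ c') →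
      (∀ e ∈ A, Agrees c e) → ∀ e ∈ A, Agrees c' e := by
    intro c c' h hc e he
    obtain ⟨v, w, hvw, -⟩ := exists_ends e
    have hv : v ∈ Λ := mem_edgesIn.1 (hA he) v (by simp [hvw])
    have hw : w ∈ Λ := mem_edgesIn.1 (hA he) w (by simp [hvw])
    rw [agrees_iff hvw, ← h v hv, ← h w hw]
    exact (agrees_iff hvw).1 (hc e he)
  refine Finset.card_nbij' (fun c => (c \ Λ, c ∩ Λ)) (fun q => q.1 ∪ q.2) ?_ ?_ ?_ ?_
  · intro c hc
    rw [Finset.mem_coe, mem_colourings] at hc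
    rw [Finset.mem_coe, Finset.mem_product, Finset.mem_powerset, mem_colourings]
    refine ⟨Finset.sdiff_subset_sdiff hc.1 Finset.Subset.rfl, Finset.inter_subset_right,
      key c _ (fun v hv => by simp [hv]) hc.2.1, by simp⟩
  · rintro ⟨c₁, c₂⟩ hc
    rw [Finset.mem_coe, Finset.mem_product, Finset.mem_powerset, mem_colourings] at hc
    obtain ⟨h1, h2, h3, -⟩ := hc
    rw [Finset.mem_coe, mem_colourings]
    refine ⟨Finset.union_subset (h1.trans Finset.sdiff_subset) (h2.trans hΛ),
      key c₂ _ (fun v hv => ?_) h3, by simp⟩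
    have : v ∉ c₁ := fun h => (Finset.mem_sdiff.1 (h1 h)).2 hv
    simp [this]
  · intro c _
    exact Finset.sdiff_union_inter c Λ
  · rintro ⟨c₁, c₂⟩ hc
    rw [Finset.mem_coe, Finset.mem_product, Finset.mem_powerset, mem_colourings] at hc
    obtain ⟨h1, h2, -⟩ := hc
    refine Prod.ext ?_ ?_
    · ext v
      have := @h1 v
      have := @h2 v
      simp only [Finset.mem_sdiff, Finset.mem_union] at *
      tauto
    · ext v
      have := @h1 v
      have := @h2 v
      simp only [Finset.mem_sdiff, Finset.mem_union, Finset.mem_inter] at *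
      tauto

/-- The unnormalized random-cluster weight for `q = 2`. -/
noncomputable def fkWeight (y : ℝ) (Λ : Finset Vertex) (A : Finset Edge) : ℝ :=
  y ^ A.card * (colourings Λ A ∅).card

theorem fkWeight_nonneg {y : ℝ} (hy : 0 ≤ y) (Λ : Finset Vertex) (A : Finset Edge) :
    0 ≤ fkWeight y Λ A := by
  unfold fkWeight
  positivity

theorem sum_fkWeight_pos {y : ℝ} (hy : 0 ≤ y) (Λ : Finset Vertex) :
    0 < ∑ A ∈ (edgesIn Λ).powerset, fkWeight y Λ A := by
  have := spinWeight_univ_pos (r := 0) (Λ := Λ) (E := edgesIn Λ) (B := ∅) hy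
  rwa [spinWeight_univ] at this

/-- The random-cluster measure on the finite graph spanned by `Λ`, as a measure. -/
noncomputable def rcMeasure (y : ℝ) (Λ : Finset Vertex) : Measure EdgeConfig :=
  ∑ A ∈ (edgesIn Λ).powerset,
    ENNReal.ofReal (fkWeight y Λ A / ∑ A ∈ (edgesIn Λ).powerset, fkWeight y Λ A) •
      Measure.dirac (configOf A)

variable {y p : ℝ} {Λ Λ' : Finset Vertex}

instance : IsFiniteMeasure (rcMeasure y Λ) := by
  unfold rcMeasure
  have : ∀ A, IsFiniteMeasure (ENNReal.ofReal
    (fkWeight y Λ A / ∑ A ∈ (edgesIn Λ).powerset, fkWeight y Λ A) •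
      Measure.dirac (configOf A)) := fun A => Measure.smul_finite _ ENNReal.ofReal_ne_top
  infer_instance

theorem integral_rcMeasure (hy : 0 ≤ y) (G : EdgeConfig → ℝ) :
    ∫ η, G η ∂(rcMeasure y Λ) = (∑ A ∈ (edgesIn Λ).powerset, fkWeight y Λ A * G (configOf A)) /
      ∑ A ∈ (edgesIn Λ).powerset, fkWeight y Λ A := by
  rw [rcMeasure, integral_finsetSum_measure, Finset.sum_div]
  · refine Finset.sum_congr rfl fun A _ => ?_
    rw [integral_smul_measure, integral_dirac, ENNReal.toReal_ofReal (div_nonneg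
      (fkWeight_nonneg hy _ _) (sum_fkWeight_pos hy _).le), smul_eq_mul]
    ring
  · intro A _
    exact (integrable_dirac (by simp)).smul_measure ENNReal.ofReal_ne_top

open Classical in
theorem rcMeasure_real (hy : 0 ≤ y) {S : Set EdgeConfig} (hS : MeasurableSet S) :
    (rcMeasure y Λ).real S = (∑ A ∈ (edgesIn Λ).powerset with configOf A ∈ S, fkWeight y Λ A) /
      ∑ A ∈ (edgesIn Λ).powerset, fkWeight y Λ A := by
  rw [← integral_indicator_one hS, integral_rcMeasure hy, Finset.sum_filter]
  congr 1
  refine Finset.sum_congr rfl fun A _ => ?_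
  by_cases h : configOf A ∈ S <;> simp [h]

/-- The factor $(1-p)^{|E|}$ is common to all weights and cancels, leaving weight $p/(1-p)$ per open
edge. -/
theorem rcProb_eq (hp0 : 0 ≤ p) (hp1 : p < 1) {S : Set EdgeConfig} (hS : MeasurableSet S) :
    rcProb p 2 Λ S = (rcMeasure (p / (1 - p)) Λ).real S := by
  classical
  have h1 : 0 < 1 - p := by linarith
  rw [rcMeasure_real (div_nonneg hp0 h1.le) hS, rcProb]
  have key : ∀ A ∈ (edgesIn Λ).powerset,
      rcWeight p 2 Λ A = (1 - p) ^ (edgesIn Λ).card * fkWeight (p / (1 - p)) Λ A := by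
    intro A hA
    have hA := Finset.mem_powerset.1 hA
    have h2 : ((2 : ℝ) ^ numClusters Λ (configOf A)) = (colourings Λ A ∅).card := by
      exact_mod_cast two_pow_numClusters hA
    have h3 := Finset.card_le_card hA
    rw [rcWeight, fkWeight, h2, div_pow, ← Nat.sub_add_cancel h3, Nat.add_sub_cancel, pow_add]
    field_simp
  have h2 : (1 - p) ^ (edgesIn Λ).card ≠ 0 := by positivity
  rw [Finset.sum_congr rfl key, Finset.sum_congr rfl fun A hA =>
    key A (Finset.mem_filter.1 hA).1, ← Finset.mul_sum, ← Finset.mul_sum, mul_div_mul_left _ _ h2]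

/-- The random-cluster measures increase with the domain. -/
theorem rcMeasure_real_mono (hy : 0 ≤ y) (hΛ : Λ ⊆ Λ') {S : Set EdgeConfig}
    (hSm : MeasurableSet S) (hS : ∀ A A' : Finset Edge, A ⊆ A' → configOf A ∈ S → configOf A' ∈ S) :
    (rcMeasure y Λ).real S ≤ (rcMeasure y Λ').real S := by
  classical
  have hE : edgesIn Λ ⊆ edgesIn Λ' := fun e he =>
    mem_edgesIn.2 fun v hv => hΛ (mem_edgesIn.1 he v hv)
  -- Seen in the larger domain, a configuration in `Λ` gains only isolated vertices. The constant
  -- factor cancels, and the four functions inequality compares the two edge sets over the same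
  -- vertices.
  have key : ∀ A ∈ (edgesIn Λ).powerset,
      fkWeight y Λ' A = 2 ^ (Λ' \ Λ).card * fkWeight y Λ A := by
    intro A hA
    rw [fkWeight, fkWeight, card_colourings_of_subset hΛ (Finset.mem_powerset.1 hA)]
    push_cast
    ring
  have h := sum_mul_sum_le (Λ := Λ') hy (fun A => configOf A ∈ S) hS (edgesIn Λ) (edgesIn Λ') ∅ ∅
  rw [Finset.inter_eq_left.2 hE, Finset.union_eq_right.2 hE, Finset.inter_self,
    Finset.union_self] at h
  change (∑ A ∈ (edgesIn Λ).powerset with configOf A ∈ S, fkWeight y Λ' A) *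
    (∑ A ∈ (edgesIn Λ').powerset, fkWeight y Λ' A) ≤
    (∑ A ∈ (edgesIn Λ).powerset, fkWeight y Λ' A) *
    (∑ A ∈ (edgesIn Λ').powerset with configOf A ∈ S, fkWeight y Λ' A) at h
  rw [Finset.sum_congr rfl key, Finset.sum_congr rfl fun A hA =>
    key A (Finset.mem_filter.1 hA).1, ← Finset.mul_sum, ← Finset.mul_sum, mul_assoc, mul_assoc] at h
  have h' := le_of_mul_le_mul_left h (by positivity)
  rw [rcMeasure_real hy hSm, rcMeasure_real hy hSm, div_le_div_iff₀ (sum_fkWeight_pos hy _)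
    (sum_fkWeight_pos hy _)]
  linarith

/-! ### Convergence of functions of finitely many connection events -/

theorem integral_comp_of_fintype {Ω T : Type*} [MeasurableSpace Ω] [Fintype T] (P : Measure Ω)
    [IsFiniteMeasure P] (φ : Ω → T) (hφ : ∀ t, MeasurableSet (φ ⁻¹' {t})) (g : T → ℝ) :
    ∫ ω, g (φ ω) ∂P = ∑ t, P.real (φ ⁻¹' {t}) * g t := by
  let _ : MeasurableSpace T := ⊤
  have hm : Measurable φ := measurable_to_countable' hφ
  have hg : Measurable g := measurable_from_top
  rw [← integral_map hm.aemeasurable hg.aestronglyMeasurable,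
    integral_fintype (Integrable.of_finite)]
  refine Finset.sum_congr rfl fun t _ => ?_
  rw [map_measureReal_apply hm (hs := trivial), smul_eq_mul]

theorem tendsto_integral_of_fintype {Ω T : Type*} [MeasurableSpace Ω] [Fintype T]
    {P : ℕ → Measure Ω} [∀ n, IsFiniteMeasure (P n)] {Q : Measure Ω} [IsFiniteMeasure Q]
    {φ : Ω → T} (hφ : ∀ t, MeasurableSet (φ ⁻¹' {t}))
    (h : ∀ t, Tendsto (fun n => (P n).real (φ ⁻¹' {t})) atTop (𝓝 (Q.real (φ ⁻¹' {t}))))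
    (g : T → ℝ) :
    Tendsto (fun n => ∫ ω, g (φ ω) ∂(P n)) atTop (𝓝 (∫ ω, g (φ ω) ∂Q)) := by
  simp only [integral_comp_of_fintype _ φ hφ g]
  exact tendsto_finsetSum _ fun t _ => (h t).mul_const _

/-- If the probabilities of all finite intersections of the events `S j` converge, so do the
probabilities of the atoms that these events generate. -/
theorem tendsto_atom {Ω J : Type*} [MeasurableSpace Ω] [Fintype J] [DecidableEq J]
    {P : ℕ → Measure Ω} [∀ n, IsFiniteMeasure (P n)] {Q : Measure Ω} [IsFiniteMeasure Q]
    {φ : Ω → Finset J} (hφ : ∀ t, MeasurableSet (φ ⁻¹' {t}))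
    (h : ∀ t, Tendsto (fun n => (P n).real {ω | t ⊆ φ ω}) atTop (𝓝 (Q.real {ω | t ⊆ φ ω})))
    (t : Finset J) :
    Tendsto (fun n => (P n).real (φ ⁻¹' {t})) atTop (𝓝 (Q.real (φ ⁻¹' {t}))) := by
  have key : ∀ (P : Measure Ω) [IsFiniteMeasure P] (t : Finset J), P.real (φ ⁻¹' {t}) =
      P.real {ω | t ⊆ φ ω} - ∑ t' ∈ Finset.univ.filter (fun t' => t ⊂ t'), P.real (φ ⁻¹' {t'}) := by
    intro P _ t
    have h1 : {ω | t ⊆ φ ω} =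
        ⋃ t' ∈ Finset.univ.filter (fun t' => t ⊆ t'), φ ⁻¹' {t'} := by
      ext ω; simp
    have h2 : Finset.univ.filter (fun t' => t ⊆ t') =
        insert t (Finset.univ.filter (fun t' => t ⊂ t')) := by
      ext t'
      simp only [Finset.mem_filter, Finset.mem_univ, true_and, Finset.mem_insert]
      exact (le_iff_eq_or_lt (a := t) (b := t')).trans (or_congr_left eq_comm)
    rw [h1, measureReal_biUnion_finset (fun a _ b _ hab => Disjoint.preimage _ (by simpa using hab))
      (fun t _ => hφ t), h2, Finset.sum_insert (by simp)]
    ring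
  -- Möbius inversion from the largest sets downwards.
  induction t using WellFoundedGT.induction with
  | ind t ih =>
    simp only [key _ t]
    exact (h t).sub (tendsto_finsetSum _ fun t' ht' => ih t' (by simpa using ht'))

/-! ### Connection events and the weak limit -/

/-- An event that is determined by the openness of finitely many edges whenever it occurs. -/
def IsOpenUp (S : Set EdgeConfig) : Prop :=
  ∀ η ∈ S, ∃ A : Finset Edge, (∀ e ∈ A, η e = true) ∧
    ∀ η' : EdgeConfig, (∀ e ∈ A, η' e = true) → η' ∈ S

theorem isOpenUp_iInter {J : Type*} {S : J → Set EdgeConfig} (hS : ∀ j, IsOpenUp (S j))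
    (t : Finset J) : IsOpenUp {η | ∀ j ∈ t, η ∈ S j} := by
  classical
  intro η hη
  choose! A hA hA' using fun j (hj : j ∈ t) => hS j η (hη j hj)
  refine ⟨t.biUnion A, fun e he => ?_, fun η' h j hj => hA' j hj η' fun e he => h e ?_⟩
  · obtain ⟨j, hj, he⟩ := Finset.mem_biUnion.1 he
    exact hA j hj e he
  · exact Finset.mem_biUnion.2 ⟨j, hj, he⟩

theorem isOpenUp_reachable (v w : Vertex) :
    IsOpenUp {η : EdgeConfig | (openGraph η).Reachable v w} := by
  classical
  rintro η ⟨q⟩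
  induction q with
  | nil => exact ⟨∅, by simp, fun η' _ => SimpleGraph.Reachable.refl _⟩
  | cons hadj q ih =>
    obtain ⟨A, hA, hA'⟩ := ih
    obtain ⟨h, ho⟩ := hadj
    refine ⟨insert (⟨s(_, _), h⟩ : Edge) A, ?_, fun η' hη' => ?_⟩
    · rw [Finset.forall_mem_insert]
      exact ⟨ho, hA⟩
    · rw [Finset.forall_mem_insert] at hη'
      exact (SimpleGraph.Adj.reachable (G := openGraph η') ⟨h, hη'.1⟩).trans (hA' η' hη'.2)

theorem isOpenUp_edge (e : Edge) : IsOpenUp {η : EdgeConfig | η e = true} :=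
  fun η hη => ⟨{e}, by simpa using hη, fun η' h => h e (by simp)⟩

open Classical in
/-- The configuration that agrees with `η` in `Λ` and is closed elsewhere. -/
noncomputable def truncate (Λ : Finset Vertex) (η : EdgeConfig) : EdgeConfig :=
  configOf {e ∈ edgesIn Λ | η e = true}

theorem truncate_eq_true {η : EdgeConfig} {e : Edge} :
    truncate Λ η e = true ↔ e ∈ edgesIn Λ ∧ η e = true := by
  simp [truncate, configOf_eq_true]

theorem IsOpenUp.mono {S : Set EdgeConfig} (hS : IsOpenUp S) {η η' : EdgeConfig}
    (h : ∀ e, η e = true → η' e = true) (hη : η ∈ S) : η' ∈ S := by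
  obtain ⟨A, hA, hA'⟩ := hS η hη
  exact hA' η' fun e he => h e (hA e he)

theorem box_mono {m n : ℕ} (h : m ≤ n) : box m ⊆ box n := by
  intro v hv
  simp only [box, Finset.mem_product, Finset.mem_Icc] at *
  omega

theorem exists_mem_box (s : Finset Vertex) : ∃ n, s ⊆ box n := by
  induction s using Finset.induction_on with
  | empty => exact ⟨0, by simp⟩
  | insert v s _ ih =>
    obtain ⟨n, hn⟩ := ih
    refine ⟨max n (max v.1.natAbs v.2.natAbs), Finset.insert_subset ?_
      (hn.trans (box_mono (le_max_left _ _)))⟩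
    simp only [box, Finset.mem_product, Finset.mem_Icc]
    omega

theorem exists_subset_edgesIn_box (A : Finset Edge) : ∃ n, A ⊆ edgesIn (box n) := by
  classical
  obtain ⟨n, hn⟩ := exists_mem_box (A.biUnion fun e => e.1.toFinset)
  refine ⟨n, fun e he => mem_edgesIn.2 fun v hv => hn ?_⟩
  exact Finset.mem_biUnion.2 ⟨e, he, by simpa using hv⟩

theorem IsOpenUp.eq_iUnion {S : Set EdgeConfig} (hS : IsOpenUp S) :
    S = ⋃ n : ℕ, truncate (box n) ⁻¹' S := by
  ext η
  simp only [Set.mem_iUnion, Set.mem_preimage]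
  constructor
  · intro hη
    obtain ⟨A, hA, hA'⟩ := hS η hη
    obtain ⟨n, hn⟩ := exists_subset_edgesIn_box A
    exact ⟨n, hA' _ fun e he => truncate_eq_true.2 ⟨hn he, hA e he⟩⟩
  · rintro ⟨n, hn⟩
    exact hS.mono (fun e he => (truncate_eq_true.1 he).2) hn

theorem measurableSet_cylinder (F : Finset Edge) (ζ : EdgeConfig) :
    MeasurableSet {η : EdgeConfig | ∀ e ∈ F, η e = ζ e} := by
  have : {η : EdgeConfig | ∀ e ∈ F, η e = ζ e} = ⋂ e ∈ F, (fun η : EdgeConfig => η e) ⁻¹' {ζ e} := by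
    ext η; simp
  rw [this]
  exact Finset.measurableSet_biInter _ fun e _ => measurable_pi_apply e (measurableSet_singleton _)

open Classical in
/-- The open edges of `η` in `F`. -/
noncomputable def openIn (F : Finset Edge) (η : EdgeConfig) : F.powerset :=
  ⟨{e ∈ F | η e = true}, by simp⟩

theorem openIn_preimage (F : Finset Edge) (A : F.powerset) :
    openIn F ⁻¹' {A} = {η : EdgeConfig | ∀ e ∈ F, η e = configOf A e} := by
  classical
  obtain ⟨A, hA⟩ := A
  have hA' := Finset.mem_powerset.1 hA
  ext η
  simp only [Set.mem_preimage, Set.mem_singleton_iff, Set.mem_ofPred_eq, openIn, Subtype.mk.injEq]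
  constructor
  · rintro rfl e he
    rw [Bool.eq_iff_iff, configOf_eq_true]
    simp [he]
  · intro h
    ext e
    rw [Finset.mem_filter]
    constructor
    · rintro ⟨h1, h2⟩
      rwa [h e h1, configOf_eq_true] at h2
    · intro he
      exact ⟨hA' he, by rw [h e (hA' he), configOf_eq_true]; exact he⟩

variable {ν : Measure EdgeConfig}

theorem measurableSet_truncate (S : Set EdgeConfig) : MeasurableSet (truncate Λ ⁻¹' S) := by
  classical
  have : truncate Λ ⁻¹' S = ⋃ A ∈ {A : (edgesIn Λ).powerset | configOf A.1 ∈ S},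
      openIn (edgesIn Λ) ⁻¹' {A} := by
    ext η
    simp [truncate, openIn]
  rw [this]
  refine MeasurableSet.biUnion (Set.to_countable _) fun A _ => ?_
  rw [openIn_preimage]
  exact measurableSet_cylinder _ _

theorem IsOpenUp.measurableSet {S : Set EdgeConfig} (hS : IsOpenUp S) : MeasurableSet S := by
  rw [hS.eq_iUnion]
  exact MeasurableSet.iUnion fun n => measurableSet_truncate S

/-- The truncated event depends on finitely many edges, so it is a finite union of cylinders,
whatever `S` is. -/
theorem tendsto_rcMeasure_truncate (hp0 : 0 ≤ p) (hp1 : p < 1)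
    (hν : IsRandomClusterMeasure p 2 ν) (S : Set EdgeConfig) (Λ : Finset Vertex) :
    Tendsto (fun n => (rcMeasure (p / (1 - p)) (box n)).real (truncate Λ ⁻¹' S)) atTop
      (𝓝 (ν.real (truncate Λ ⁻¹' S))) := by
  classical
  have := hν.isProbabilityMeasure
  have hφ : ∀ A, MeasurableSet (openIn (edgesIn Λ) ⁻¹' {A}) := fun A => by
    rw [openIn_preimage]
    exact measurableSet_cylinder _ _
  have h := tendsto_integral_of_fintype (P := fun n => rcMeasure (p / (1 - p)) (box n)) (Q := ν)
    hφ (fun A => by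
      rw [openIn_preimage]
      refine (hν.tendsto_cylinder _ _).congr fun n => ?_
      exact rcProb_eq hp0 hp1 (measurableSet_cylinder _ _))
    (fun A => if configOf A.1 ∈ S then 1 else 0)
  have h' : ∀ P : Measure EdgeConfig, ∫ η, (if configOf (openIn (edgesIn Λ) η).1 ∈ S then (1 : ℝ)
      else 0) ∂P = P.real (truncate Λ ⁻¹' S) := by
    intro P
    rw [← integral_indicator_one (measurableSet_truncate S)]
    refine integral_congr_ae (Eventually.of_forall fun η => ?_)
    change (if truncate Λ η ∈ S then (1 : ℝ) else 0) = _
    by_cases h : truncate Λ η ∈ S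
    · rw [if_pos h, Set.indicator_of_mem (by exact h), Pi.one_apply]
    · rw [if_neg h, Set.indicator_of_notMem (by exact h)]
  simpa only [h'] using h

/-- The upper bound comes from monotonicity in the box, the lower bound from approximating `S` from
inside by its truncations, which are local. -/
theorem tendsto_rcMeasure_of_isOpenUp (hp0 : 0 ≤ p) (hp1 : p < 1)
    (hν : IsRandomClusterMeasure p 2 ν) {S : Set EdgeConfig} (hS : IsOpenUp S) :
    Tendsto (fun n => (rcMeasure (p / (1 - p)) (box n)).real S) atTop (𝓝 (ν.real S)) := by
  classical
  have := hν.isProbabilityMeasure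
  have hy : 0 ≤ p / (1 - p) := div_nonneg hp0 (by linarith)
  have hsub : ∀ Λ, truncate Λ ⁻¹' S ⊆ S := fun Λ η h =>
    hS.mono (fun e he => (truncate_eq_true.1 he).2) h
  have hmono : Monotone fun n : ℕ => truncate (box n) ⁻¹' S := by
    intro m n hmn η h
    refine hS.mono (fun e he => ?_) h
    rw [truncate_eq_true, mem_edgesIn] at *
    exact ⟨fun v hv => box_mono hmn (he.1 v hv), he.2⟩
  have hupper : ∀ n, (rcMeasure (p / (1 - p)) (box n)).real S ≤ ν.real S := by
    intro n
    have h1 : (rcMeasure (p / (1 - p)) (box n)).real S =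
        (rcMeasure (p / (1 - p)) (box n)).real (truncate (box n) ⁻¹' S) := by
      rw [rcMeasure_real hy hS.measurableSet, rcMeasure_real hy (measurableSet_truncate S)]
      congr 2
      refine Finset.filter_congr fun A hA => ?_
      have hA := Finset.mem_powerset.1 hA
      have : truncate (box n) (configOf A) = configOf A := by
        ext e
        rw [Bool.eq_iff_iff, truncate_eq_true, configOf_eq_true]
        exact ⟨fun h => h.2, fun h => ⟨hA h, h⟩⟩
      rw [Set.mem_preimage, this]
    have h2 := tendsto_rcMeasure_truncate hp0 hp1 hν S (box n)
    rw [h1]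
    -- The truncated event is local and increasing: its probabilities in larger boxes dominate the
    -- one in box `n` and converge to the limit measure.
    refine (ge_of_tendsto h2 (eventually_atTop.2 ⟨n, fun m hm => ?_⟩)).trans
      (measureReal_mono (hsub _) (measure_ne_top _ _))
    refine rcMeasure_real_mono hy (box_mono hm) (measurableSet_truncate S) fun A A' hA h => ?_
    refine hS.mono (fun e he => ?_) h
    rw [truncate_eq_true, configOf_eq_true] at *
    exact ⟨he.1, hA he.2⟩
  refine tendsto_order.2 ⟨fun a ha => ?_, fun a ha => Eventually.of_forall fun n =>
    (hupper n).trans_lt ha⟩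
  have hlim : Tendsto (fun m : ℕ => ν.real (truncate (box m) ⁻¹' S)) atTop (𝓝 (ν.real S)) := by
    have h := tendsto_measure_iUnion_atTop (μ := ν) hmono
    rw [← hS.eq_iUnion] at h
    exact (ENNReal.tendsto_toReal (measure_ne_top _ _)).comp h
  obtain ⟨m, hm⟩ := (hlim.eventually_const_lt ha).exists
  filter_upwards [(tendsto_rcMeasure_truncate hp0 hp1 hν S (box m)).eventually_const_lt hm] with n hn
  exact hn.trans_le (measureReal_mono (hsub _) (measure_ne_top _ _))

theorem tendsto_integral_rcMeasure (hp0 : 0 ≤ p) (hp1 : p < 1)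
    (hν : IsRandomClusterMeasure p 2 ν) {J : Type*} [Fintype J] {S : J → Set EdgeConfig}
    (hS : ∀ j, IsOpenUp (S j)) {G : EdgeConfig → ℝ}
    (hG : ∀ η η', (∀ j, η ∈ S j ↔ η' ∈ S j) → G η = G η') :
    Tendsto (fun n => ∫ η, G η ∂(rcMeasure (p / (1 - p)) (box n))) atTop (𝓝 (∫ η, G η ∂ν)) := by
  classical
  have := hν.isProbabilityMeasure
  set φ : EdgeConfig → Finset J := fun η => {j | η ∈ S j}
  have hφmem : ∀ η j, j ∈ φ η ↔ η ∈ S j := fun η j => by simp [φ]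
  have hφ : ∀ t, MeasurableSet (φ ⁻¹' {t}) := by
    intro t
    have : φ ⁻¹' {t} = ⋂ j, {η | η ∈ S j ↔ j ∈ t} := by
      ext η
      simp [Finset.ext_iff, hφmem]
    rw [this]
    refine MeasurableSet.iInter fun j => ?_
    by_cases h : j ∈ t
    · have : {η | η ∈ S j ↔ j ∈ t} = S j := by ext η; simp [h]
      rw [this]
      exact (hS j).measurableSet
    · have : {η | η ∈ S j ↔ j ∈ t} = (S j)ᶜ := by ext η; simp [h]
      rw [this]
      exact (hS j).measurableSet.compl
  have hfac : Function.FactorsThrough G φ := fun η η' h => hG η η' fun j => by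
    rw [← hφmem, h, hφmem]
  obtain ⟨g, hg⟩ := (Function.factorsThrough_iff G).1 hfac
  subst hg
  refine tendsto_integral_of_fintype hφ (tendsto_atom hφ fun t => ?_) g
  have : {η | t ⊆ φ η} = {η | ∀ j ∈ t, η ∈ S j} := by
    ext η
    simp [Finset.subset_iff, hφmem]
  rw [this]
  exact tendsto_rcMeasure_of_isOpenUp hp0 hp1 hν (isOpenUp_iInter hS t)

end TriFK

namespace TriFK

variable {y p : ℝ} {Λ : Finset Vertex} {E B : Finset Edge} {U F : Finset Vertex} {r : unitInterval}
  {ν : Measure EdgeConfig} {D : Set SpinConfig}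

/-! ### Convergence of the probabilities of local events -/

/-- The event that the edges of `B` are closed and the spins lie in `D`. -/
def closedSpinEvent (B : Finset Edge) (D : Set SpinConfig) : Set Config :=
  {ω | (∀ e ∈ B, ω.1 e = false) ∧ ω.2 ∈ D}

theorem measurableSet_closedSpinEvent (hD : MeasurableSet D) :
    MeasurableSet (closedSpinEvent B D) := by
  have h1 := measurableSet_cylinder B (fun _ => false)
  exact (measurable_fst h1).inter (measurable_snd hD)

open Classical in
/-- The conditional probability of `closedSpinEvent B D` given the edge configuration. -/
noncomputable def spinProb (r : unitInterval) (B : Finset Edge) (D : Set SpinConfig)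
    (η : EdgeConfig) : ℝ :=
  if ∀ e ∈ B, η e = false then (coin r).real {τ | (colour (η, τ)).2 ∈ D} else 0

theorem divideAndColour_real [IsProbabilityMeasure ν] (hD : MeasurableSet D) :
    (divideAndColour ν r).real (closedSpinEvent B D) = ∫ η, spinProb r B D η ∂ν := by
  have hm := measurable_colour (measurableSet_closedSpinEvent (B := B) hD)
  rw [divideAndColour, map_measureReal_apply measurable_colour (measurableSet_closedSpinEvent hD),
    measureReal_def, Measure.prod_apply hm, ← integral_toReal
      (measurable_measure_prodMk_left hm).aemeasurable
      (Eventually.of_forall fun η => measure_lt_top _ _)]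
  refine integral_congr_ae (Eventually.of_forall fun η => ?_)
  simp only [spinProb]
  split_ifs with h
  · rw [measureReal_def]
    congr 2
    ext τ
    exact ⟨And.right, fun h' => ⟨h, h'⟩⟩
  · have : Prod.mk η ⁻¹' (colour ⁻¹' closedSpinEvent B D) = ∅ := by
      refine Set.eq_empty_of_forall_notMem fun τ hτ => h hτ.1
    rw [this]
    simp

theorem integral_spinProb_rcMeasure (hy : 0 ≤ y) :
    ∫ η, spinProb r B D η ∂(rcMeasure y Λ) =
      spinWeight y r Λ (edgesIn Λ \ B) ∅ D / spinWeight y r Λ (edgesIn Λ) ∅ Set.univ := by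
  classical
  rw [integral_rcMeasure hy, spinWeight_univ]
  congr 1
  have h1 : (edgesIn Λ \ B).powerset =
      {A ∈ (edgesIn Λ).powerset | ∀ e ∈ B, configOf A e = false} := by
    ext A
    simp only [Finset.mem_filter, Finset.mem_powerset, ← Bool.not_eq_true, configOf_eq_true]
    rw [Finset.subset_sdiff, Finset.disjoint_right]
  rw [spinWeight, h1, Finset.sum_filter]
  refine Finset.sum_congr rfl fun A _ => ?_
  simp only [spinProb, plantedSpin_empty, fkWeight]
  split_ifs
  · rfl
  · simp

theorem clusterLabel_le (η : EdgeConfig) (v : Vertex) : clusterLabel η v ≤ Encodable.encode v :=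
  Nat.sInf_le ⟨v, SimpleGraph.Reachable.refl v, rfl⟩

/-- The label of a vertex is determined by its connections to the vertices of smaller code. -/
theorem clusterLabel_le_of_reachable_iff {η η' : EdgeConfig} {v : Vertex}
    (h : ∀ w, Encodable.encode w ≤ Encodable.encode v →
      ((openGraph η).Reachable v w → (openGraph η').Reachable v w)) :
    clusterLabel η' v ≤ clusterLabel η v := by
  obtain ⟨w, hw, hw'⟩ := exists_encode_eq_clusterLabel η v
  have := h w (hw' ▸ clusterLabel_le η v) hw
  rw [← hw']
  exact Nat.sInf_le ⟨w, this, rfl⟩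

/-- Labels being least codes, those of the vertices of `F` are determined by connections to finitely
many vertices. Together with the states of the edges of `B` these decide `spinProb`, so finitely
many open-up events suffice. -/
theorem tendsto_spinWeight (hp0 : 0 ≤ p) (hp1 : p < 1) (hν : IsRandomClusterMeasure p 2 ν)
    (hD : MeasurableSet D) (hF : ∀ σ σ' : SpinConfig, (∀ v ∈ F, σ v = σ' v) → σ ∈ D → σ' ∈ D) :
    Tendsto (fun n => spinWeight (p / (1 - p)) r (box n) (edgesIn (box n) \ B) ∅ D /
      spinWeight (p / (1 - p)) r (box n) (edgesIn (box n)) ∅ Set.univ) atTop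
      (𝓝 ((divideAndColour ν r).real (closedSpinEvent B D))) := by
  classical
  have := hν.isProbabilityMeasure
  have hy : 0 ≤ p / (1 - p) := div_nonneg hp0 (by linarith)
  simp only [divideAndColour_real hD, ← integral_spinProb_rcMeasure hy]
  have hfin : {q : Vertex × Vertex | q.1 ∈ F ∧
      Encodable.encode q.2 ≤ Encodable.encode q.1}.Finite := by
    have h1 : ∀ n : ℕ, {w : Vertex | Encodable.encode w ≤ n}.Finite := fun n =>
      (Set.finite_Iic n).preimage Encodable.encode_injective.injOn
    refine (F.finite_toSet.biUnion fun v _ =>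
      ((Set.finite_singleton v).prod (h1 (Encodable.encode v)))).subset ?_
    rintro ⟨v, w⟩ ⟨hv, hw⟩
    simp only [Set.mem_iUnion]
    exact ⟨v, hv, rfl, hw⟩
  set T := hfin.toFinset
  refine tendsto_integral_rcMeasure (J := T ⊕ B) hp0 hp1 hν
    (S := Sum.elim (fun q => {η | (openGraph η).Reachable q.1.1 q.1.2}) (fun e => {η | η e.1 = true}))
    ?_ ?_
  · rintro (q | e)
    · exact isOpenUp_reachable _ _
    · exact isOpenUp_edge _
  · intro η η' h
    have h1 : ∀ v ∈ F, ∀ w, Encodable.encode w ≤ Encodable.encode v →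
        ((openGraph η).Reachable v w ↔ (openGraph η').Reachable v w) := fun v hv w hw =>
      h (.inl ⟨(v, w), hfin.mem_toFinset.2 ⟨hv, hw⟩⟩)
    have h2 : ∀ e ∈ B, (η e = true ↔ η' e = true) := fun e he => h (.inr ⟨e, he⟩)
    have h3 : ∀ v ∈ F, clusterLabel η v = clusterLabel η' v := fun v hv =>
      le_antisymm (clusterLabel_le_of_reachable_iff fun w hw => (h1 v hv w hw).2)
        (clusterLabel_le_of_reachable_iff fun w hw => (h1 v hv w hw).1)
    have h4 : (∀ e ∈ B, η e = false) ↔ ∀ e ∈ B, η' e = false := by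
      refine forall₂_congr fun e he => ?_
      rw [← Bool.not_eq_true, ← Bool.not_eq_true, h2 e he]
    have h5 : {τ | (colour (η, τ)).2 ∈ D} = {τ | (colour (η', τ)).2 ∈ D} := by
      ext τ
      have h6 : ∀ v ∈ F, (colour (η, τ)).2 v = (colour (η', τ)).2 v := fun v hv => by
        simp [colour, h3 v hv]
      exact ⟨hF _ _ h6, hF _ _ fun v hv => (h6 v hv).symm⟩
    simp only [spinProb, h5]
    exact if_congr h4 rfl rfl

/-! ### Lower bounds -/

theorem spinWeight_univ_le_mul_erase (hy : 0 ≤ y) (E : Finset Edge) (e : Edge) :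
    spinWeight y r Λ E ∅ Set.univ ≤ (1 + y) * spinWeight y r Λ (E.erase e) ∅ Set.univ := by
  by_cases he : e ∈ E
  · conv_lhs => rw [← Finset.insert_erase he]
    rw [spinWeight_univ, spinWeight_univ, Finset.sum_powerset_insert (Finset.notMem_erase e E),
      add_mul, one_mul, Finset.mul_sum]
    refine add_le_add_right (Finset.sum_le_sum fun η hη => ?_) _
    have h1 : e ∉ η := fun h => Finset.notMem_erase e E (Finset.mem_powerset.1 hη h)
    have h2 : ((colourings Λ (insert e η) ∅).card : ℝ) ≤ (colourings Λ η ∅).card := by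
      -- Opening `e` adds a constraint on colourings, so it multiplies a weight by at most `y`.
      exact_mod_cast Finset.card_le_card
        (colourings_anti (Finset.subset_insert _ _) Finset.Subset.rfl)
    rw [Finset.card_insert_of_notMem h1, pow_succ']
    have := mul_le_mul_of_nonneg_left h2 (show 0 ≤ y * y ^ η.card by positivity)
    linarith
  · rw [Finset.erase_eq_of_notMem he]
    have := spinWeight_nonneg (r := r) (Λ := Λ) (E := E) (B := ∅) (D := Set.univ) hy
    nlinarith

theorem spinWeight_univ_le_mul_sdiff (hy : 0 ≤ y) (E B : Finset Edge) :
    spinWeight y r Λ E ∅ Set.univ ≤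
      (1 + y) ^ B.card * spinWeight y r Λ (E \ B) ∅ Set.univ := by
  induction B using Finset.induction_on with
  | empty => simp
  | insert e B he ih =>
    rw [Finset.card_insert_of_notMem he, Finset.sdiff_insert, pow_succ, mul_assoc]
    exact ih.trans (mul_le_mul_of_nonneg_left (spinWeight_univ_le_mul_erase hy _ _)
      (by positivity))

/-- At most `U.card` distinct coins govern the spins on `U`. -/
theorem pow_le_coin_real_minusOn (η : Finset Edge) (U : Finset Vertex) :
    (bernoulliMeasure true false r).real {false} ^ U.card ≤
      (coin r).real {τ | plantedSpin η ∅ τ ∈ minusOn U} := by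
  classical
  set L := U.image (clusterLabel (configOf η))
  have h1 : {τ | plantedSpin η ∅ τ ∈ minusOn U} = Set.pi (L : Set ℕ) (fun _ => {false}) := by
    ext τ
    simp only [minusOn, plantedSpin, L, Set.mem_ofPred_eq, Finset.coe_image, Set.mem_pi,
      Set.forall_mem_image, Finset.notMem_empty, false_and, exists_false, if_false,
      Set.mem_singleton_iff, Finset.mem_coe]
  rw [h1, measureReal_def, measureReal_def, Measure.infinitePi_pi (t := fun _ => {false}) _
    fun _ _ => measurableSet_singleton _, Finset.prod_const, ENNReal.toReal_pow]
  exact pow_le_pow_of_le_one measureReal_nonneg measureReal_le_one Finset.card_image_le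

theorem mul_spinWeight_le_spinWeight_minus (hy : 0 ≤ y) :
    (bernoulliMeasure true false r).real {false} ^ U.card * spinWeight y r Λ E ∅ Set.univ ≤
      spinWeight y r Λ E ∅ (minusOn U) := by
  rw [spinWeight_univ, spinWeight, Finset.mul_sum]
  refine Finset.sum_le_sum fun η _ => ?_
  rw [mul_comm]
  exact mul_le_mul_of_nonneg_left (pow_le_coin_real_minusOn η U) (by positivity)

theorem minusOn_local (U : Finset Vertex) : ∀ σ σ' : SpinConfig, (∀ v ∈ U, σ v = σ' v) →
    σ ∈ minusOn U → σ' ∈ minusOn U :=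
  fun _ _ h hσ u hu => (h u hu).symm.trans (hσ u hu)

/-- The lower bound $(1-r)^{|U|}/(1+y)^{|B|}$ holds in every box and so survives the limit. With `U`
empty it needs nothing of `r`, which serves the event that `B` is closed. -/
theorem divideAndColour_minus_pos (hp0 : 0 ≤ p) (hp1 : p < 1)
    (hν : IsRandomClusterMeasure p 2 ν) (B : Finset Edge) (U : Finset Vertex)
    (hr : 0 < (bernoulliMeasure true false r).real {false} ∨ U = ∅) :
    0 < (divideAndColour ν r).real (closedSpinEvent B (minusOn U)) := by
  have hy : 0 ≤ p / (1 - p) := div_nonneg hp0 (by linarith)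
  set q := (bernoulliMeasure true false r).real {false}
  have hq : 0 < q ^ U.card := by
    rcases hr with hr | rfl
    · positivity
    · simp
  have hlim := tendsto_spinWeight (r := r) (B := B) hp0 hp1 hν (measurableSet_minusOn U)
    (minusOn_local U)
  refine lt_of_lt_of_le (show 0 < q ^ U.card / (1 + p / (1 - p)) ^ B.card by positivity)
    (ge_of_tendsto' hlim fun n => ?_)
  rw [div_le_div_iff₀ (by positivity) (spinWeight_univ_pos hy)]
  have h1 := spinWeight_univ_le_mul_sdiff (r := r) (Λ := box n) hy (edgesIn (box n)) B
  have h2 := mul_spinWeight_le_spinWeight_minus (r := r) (Λ := box n) (E := edgesIn (box n) \ B)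
    (U := U) hy
  calc q ^ U.card * spinWeight (p / (1 - p)) r (box n) (edgesIn (box n)) ∅ Set.univ
      ≤ q ^ U.card * ((1 + p / (1 - p)) ^ B.card *
        spinWeight (p / (1 - p)) r (box n) (edgesIn (box n) \ B) ∅ Set.univ) :=
        mul_le_mul_of_nonneg_left h1 hq.le
    _ = (1 + p / (1 - p)) ^ B.card * (q ^ U.card *
        spinWeight (p / (1 - p)) r (box n) (edgesIn (box n) \ B) ∅ Set.univ) := by ring
    _ ≤ (1 + p / (1 - p)) ^ B.card *
        spinWeight (p / (1 - p)) r (box n) (edgesIn (box n) \ B) ∅ (minusOn U) :=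
        mul_le_mul_of_nonneg_left h2 (by positivity)
    _ = _ := mul_comm _ _

theorem divideAndColour_minus_eq_zero (hp0 : 0 ≤ p) (hp1 : p < 1)
    (hν : IsRandomClusterMeasure p 2 ν) (hU : U.Nonempty)
    (hr : (bernoulliMeasure true false r).real {false} = 0) :
    (divideAndColour ν r).real (closedSpinEvent ∅ (minusOn U)) = 0 := by
  obtain ⟨u, hu⟩ := hU
  obtain ⟨N, hN⟩ := exists_mem_box {u}
  refine tendsto_nhds_unique (tendsto_spinWeight (r := r) (B := ∅) hp0 hp1 hν
    (measurableSet_minusOn U) (minusOn_local U))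
    (tendsto_const_nhds.congr' (eventually_atTop.2 ⟨N, fun n hn => ?_⟩))
  have h := spinWeight_minus_of_isolated (y := p / (1 - p)) (r := r) (Λ := box n) (B := ∅)
    (E := edgesIn (box n) \ ∅) (D := Set.univ)
    (fun e he => mem_edgesIn.1 (Finset.sdiff_subset he)) MeasurableSet.univ (by simp)
    (box_mono hn (hN (Finset.mem_singleton_self u))) hu (by simp)
  rw [Set.univ_inter, hr] at h
  simp only [h, mul_zero, zero_mul, zero_div]

/-! ### The comparison in infinite volume for local events -/

theorem spinWeight_ratio_mul_le {a b c d Z : ℝ} (hZ : 0 < Z) (h : a * b ≤ c * d) :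
    a / Z * (b / Z) ≤ c / Z * (d / Z) := by
  rw [div_mul_div_comm, div_mul_div_comm]
  exact div_le_div_of_nonneg_right h (by positivity)

theorem inter_minusOn_local
    (hF : ∀ σ σ' : SpinConfig, (∀ v ∈ F, σ v = σ' v) → σ ∈ D → σ' ∈ D) :
    ∀ σ σ' : SpinConfig, (∀ v ∈ F ∪ U, σ v = σ' v) → σ ∈ D ∩ minusOn U → σ' ∈ D ∩ minusOn U :=
  fun _ _ h hσ => ⟨hF _ _ (fun v hv => h v (Finset.mem_union_left _ hv)) hσ.1,
    minusOn_local U _ _ (fun v hv => h v (Finset.mem_union_right _ hv)) hσ.2⟩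

theorem divideAndColour_minus_mul_closed_le (hp0 : 0 ≤ p) (hp1 : p < 1)
    (hν : IsRandomClusterMeasure p 2 ν) (hD : MeasurableSet D) (hup : IsUpperSet D)
    (hF : ∀ σ σ' : SpinConfig, (∀ v ∈ F, σ v = σ' v) → σ ∈ D → σ' ∈ D)
    (hB : ∀ e ∈ B, ∃ v ∈ e.1, v ∈ U) :
    (divideAndColour ν r).real (closedSpinEvent ∅ (D ∩ minusOn U)) *
        (divideAndColour ν r).real (closedSpinEvent B Set.univ) ≤
      (divideAndColour ν r).real (closedSpinEvent B D) *
        (divideAndColour ν r).real (closedSpinEvent ∅ (minusOn U)) := by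
  have hy : 0 ≤ p / (1 - p) := div_nonneg hp0 (by linarith)
  have hU := measurableSet_minusOn U
  obtain ⟨N, hN⟩ := exists_mem_box U
  refine le_of_tendsto_of_tendsto
    ((tendsto_spinWeight hp0 hp1 hν (hD.inter hU) (inter_minusOn_local hF)).mul
      (tendsto_spinWeight (F := ∅) hp0 hp1 hν MeasurableSet.univ (by simp)))
    ((tendsto_spinWeight hp0 hp1 hν hD hF).mul
      (tendsto_spinWeight hp0 hp1 hν hU (minusOn_local U)))
    (eventually_atTop.2 ⟨N, fun n hn => ?_⟩)
  refine spinWeight_ratio_mul_le (spinWeight_univ_pos hy) ?_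
  rw [Finset.sdiff_empty]
  refine spinWeight_minus_mul_le hy hup hD (fun e he => mem_edgesIn.1 he)
    (hN.trans (box_mono hn)) Finset.sdiff_subset fun e he he' => ?_
  obtain ⟨v, hv, hvU⟩ := hB e (by simpa [he] using he')
  exact ⟨v, hv, .inl hvU⟩

theorem divideAndColour_minus_mul_closed_minus_le (hp0 : 0 ≤ p) (hp1 : p < 1)
    (hν : IsRandomClusterMeasure p 2 ν) (hD : MeasurableSet D) (hup : IsUpperSet D)
    (hF : ∀ σ σ' : SpinConfig, (∀ v ∈ F, σ v = σ' v) → σ ∈ D → σ' ∈ D)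
    (hB : ∀ e ∈ B, ∃ v ∈ e.1, v ∈ U)
    (hB' : ∀ e ∉ B, (∀ v ∈ e.1, v ∈ U) ∨ ∀ v ∈ e.1, v ∉ U) :
    (divideAndColour ν r).real (closedSpinEvent ∅ (D ∩ minusOn U)) *
        (divideAndColour ν r).real (closedSpinEvent B (minusOn U)) ≤
      (divideAndColour ν r).real (closedSpinEvent B (D ∩ minusOn U)) *
        (divideAndColour ν r).real (closedSpinEvent ∅ (minusOn U)) := by
  have hy : 0 ≤ p / (1 - p) := div_nonneg hp0 (by linarith)
  have hU := measurableSet_minusOn U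
  obtain ⟨N, hN⟩ := exists_mem_box U
  refine le_of_tendsto_of_tendsto
    ((tendsto_spinWeight hp0 hp1 hν (hD.inter hU) (inter_minusOn_local hF)).mul
      (tendsto_spinWeight hp0 hp1 hν hU (minusOn_local U)))
    ((tendsto_spinWeight hp0 hp1 hν (hD.inter hU) (inter_minusOn_local hF)).mul
      (tendsto_spinWeight hp0 hp1 hν hU (minusOn_local U)))
    (eventually_atTop.2 ⟨N, fun n hn => ?_⟩)
  refine spinWeight_ratio_mul_le (spinWeight_univ_pos hy) ?_
  rw [Finset.sdiff_empty]
  refine spinWeight_minus_mul_minus_le hy hup hD (fun e he => mem_edgesIn.1 he)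
    (hN.trans (box_mono hn)) Finset.sdiff_subset (fun e he he' => hB e (by simpa [he] using he'))
    fun e he => hB' e (Finset.mem_sdiff.1 he).2

end TriFK

namespace TriFK

/-! ### From local to general increasing events -/

/-- An inequality between two measures for all local increasing events extends to all measurable
increasing events. -/
theorem measure_le_of_local_le {μ₁ μ₂ : Measure SpinConfig} [IsFiniteMeasure μ₁]
    [IsFiniteMeasure μ₂]
    (h : ∀ (F : Finset Vertex) (D : Set SpinConfig), MeasurableSet D → IsUpperSet D →
      (∀ σ σ' : SpinConfig, (∀ v ∈ F, σ v = σ' v) → σ ∈ D → σ' ∈ D) → μ₁ D ≤ μ₂ D)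
    {D : Set SpinConfig} (hD : MeasurableSet D) (hup : IsUpperSet D) : μ₁ D ≤ μ₂ D := by
  refine ENNReal.le_of_forall_pos_le_add fun ε hε _ => ?_
  obtain ⟨K, hKD, hK, hlt⟩ := hD.exists_isClosed_lt_add (measure_ne_top μ₁ D)
    (ENNReal.coe_ne_zero.2 hε.ne')
  refine hlt.le.trans (add_le_add_left ?_ _)
  -- `L n` is the increasing hull of what `K` looks like in box `n`: a local increasing event
  -- containing `K`.
  set L : ℕ → Set SpinConfig := fun n => {σ | ∃ k ∈ K, ∀ v ∈ box n, k v ≤ σ v}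
  have hLm : ∀ n, MeasurableSet (L n) := by
    intro n
    have : L n = (box n).restrict ⁻¹'
        {ρ : box n → Bool | ∃ k ∈ K, ∀ v : box n, k v ≤ ρ v} := by
      ext σ
      simp [L]
    rw [this]
    exact Finset.measurable_restrict _ (Set.to_countable _).measurableSet
  have hLanti : Antitone L := by
    rintro m n hmn σ ⟨k, hk, h⟩
    exact ⟨k, hk, fun v hv => h v (box_mono hmn hv)⟩
  have hKL : ∀ n, K ⊆ L n := fun n k hk => ⟨k, hk, fun _ _ => le_rfl⟩
  have hLD : ⋂ n, L n ⊆ D := by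
    intro σ hσ
    rw [Set.mem_iInter] at hσ
    have hclosed : ∀ n : ℕ, IsClosed {k : SpinConfig | k ∈ K ∧ ∀ v ∈ box n, k v ≤ σ v} := by
      intro n
      have : {k : SpinConfig | k ∈ K ∧ ∀ v ∈ box n, k v ≤ σ v} =
          K ∩ ⋂ v ∈ box n, (fun k : SpinConfig => k v) ⁻¹' {b | b ≤ σ v} := by
        ext k; simp
      rw [this]
      exact hK.inter (isClosed_biInter fun v _ =>
        (isClosed_discrete {b | b ≤ σ v}).preimage (continuous_apply v))
    -- Each box offers an element of `K` below `σ` there. Compactness yields one that is below `σ`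
    -- everywhere, and `D` is increasing.
    obtain ⟨k, hk⟩ := IsCompact.nonempty_iInter_of_sequence_nonempty_isCompact_isClosed
      (fun n : ℕ => {k : SpinConfig | k ∈ K ∧ ∀ v ∈ box n, k v ≤ σ v})
      (fun n k hk => ⟨hk.1, fun v hv => hk.2 v (box_mono n.le_succ hv)⟩)
      (fun n => by obtain ⟨k, hk, h⟩ := hσ n; exact ⟨k, hk, h⟩)
      (hclosed 0).isCompact hclosed
    rw [Set.mem_iInter] at hk
    refine hup (fun v => ?_) (hKD (hk 0).1)
    obtain ⟨n, hn⟩ := exists_mem_box {v}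
    exact (hk n).2 v (hn (Finset.mem_singleton_self v))
  have hLle : ∀ n, μ₁ (L n) ≤ μ₂ (L n) := by
    refine fun n => h (box n) _ (hLm n) ?_ ?_
    · rintro σ σ' hσ ⟨k, hk, h⟩
      exact ⟨k, hk, fun v hv => (h v hv).trans (hσ v)⟩
    · rintro σ σ' hσ ⟨k, hk, h⟩
      exact ⟨k, hk, fun v hv => (h v hv).trans (hσ v hv).le⟩
  have hlim := tendsto_measure_iInter_atTop (μ := μ₂) (fun n => (hLm n).nullMeasurableSet) hLanti
    ⟨0, measure_ne_top _ _⟩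
  exact (ge_of_tendsto' hlim fun n => (measure_mono (hKL n)).trans (hLle n)).trans
    (measure_mono hLD)

/-! ### Increasing events as spin events -/

/-- The spin event that corresponds to an increasing event. -/
def spinPart (D : Set Config) : Set SpinConfig := {σ | ((fun _ => false : EdgeConfig), σ) ∈ D}

theorem closed_mem_compatible (σ : SpinConfig) :
    ((fun _ => false : EdgeConfig), σ) ∈ compatible := by
  intro v w h
  have : w ∈ ({v} : Set Vertex) := mem_of_reachable
    (by rintro a a' ⟨_, h⟩; simp at h) rfl h
  rw [Set.mem_singleton_iff.1 this]

/-- With all edges closed every spin configuration is compatible. Comparing equal spins in both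
directions shows that the edges do not matter. -/
theorem IsIncreasing.mem_iff {D : Set Config} (hD : IsIncreasing D) {ω : Config}
    (hω : ω ∈ compatible) : ω ∈ D ↔ ω.2 ∈ spinPart D :=
  ⟨hD ω hω _ (closed_mem_compatible _) le_rfl, hD _ (closed_mem_compatible _) ω hω le_rfl⟩

theorem IsIncreasing.isUpperSet {D : Set Config} (hD : IsIncreasing D) :
    IsUpperSet (spinPart D) :=
  fun _ _ h => hD _ (closed_mem_compatible _) _ (closed_mem_compatible _) h

theorem measurableSet_spinPart {D : Set Config} (hD : MeasurableSet D) :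
    MeasurableSet (spinPart D) := measurable_prodMk_left hD

theorem colour_mem_compatible (x : EdgeConfig × (ℕ → Bool)) : colour x ∈ compatible := by
  intro v w h
  simp only [colour] at h ⊢
  rw [clusterLabel_congr h]

/-- Comparison of conditional laws from a comparison for local increasing spin events. -/
theorem cond_le_cond_of_local {ν : Measure EdgeConfig} [IsProbabilityMeasure ν] {r : unitInterval}
    {X₁ X₂ : Set Config} (hX₁ : MeasurableSet X₁) (hX₂ : MeasurableSet X₂)
    (hpos : (divideAndColour ν r).real X₁ ≠ 0 → 0 < (divideAndColour ν r).real X₂)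
    (h : ∀ (F : Finset Vertex) (D : Set SpinConfig), MeasurableSet D → IsUpperSet D →
      (∀ σ σ' : SpinConfig, (∀ v ∈ F, σ v = σ' v) → σ ∈ D → σ' ∈ D) →
      (divideAndColour ν r).real (X₁ ∩ Prod.snd ⁻¹' D) * (divideAndColour ν r).real X₂ ≤
        (divideAndColour ν r).real (X₂ ∩ Prod.snd ⁻¹' D) * (divideAndColour ν r).real X₁)
    {D : Set Config} (hDm : MeasurableSet D) (hD : IsIncreasing D) :
    cond (divideAndColour ν r) X₁ D ≤ cond (divideAndColour ν r) X₂ D := by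
  set P := divideAndColour ν r with hP
  have : IsProbabilityMeasure P := Measure.isProbabilityMeasure_map measurable_colour.aemeasurable
  by_cases h₁ : P.real X₁ = 0
  · have h₀ : P X₁ = 0 := (measureReal_eq_zero_iff).1 h₁
    have : cond P X₁ D = 0 := by
      rw [cond_apply hX₁, measure_mono_null Set.inter_subset_left h₀, mul_zero]
    rw [this]
    exact zero_le
  have hpos₂ := hpos h₁
  have hpos₁ : 0 < P.real X₁ := lt_of_le_of_ne measureReal_nonneg (Ne.symm h₁)
  have key : ∀ X : Set Config, MeasurableSet X →
      P (X ∩ D) = P (X ∩ Prod.snd ⁻¹' spinPart D) := by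
    intro X hX
    rw [hP, divideAndColour, Measure.map_apply measurable_colour (hX.inter hDm),
      Measure.map_apply measurable_colour (hX.inter (measurable_snd (measurableSet_spinPart hDm)))]
    congr 1
    ext x
    simp only [Set.mem_preimage, Set.mem_inter_iff]
    rw [hD.mem_iff (colour_mem_compatible x)]
  have hcond : ∀ X : Set Config, MeasurableSet X → ∀ D : Set SpinConfig, MeasurableSet D →
      (cond P X).map Prod.snd D = (P X)⁻¹ * P (X ∩ Prod.snd ⁻¹' D) := by
    intro X hX D hD
    rw [Measure.map_apply measurable_snd hD, cond_apply hX]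
  rw [cond_apply hX₁, cond_apply hX₂, key _ hX₁, key _ hX₂,
    ← hcond _ hX₁ _ (measurableSet_spinPart hDm), ← hcond _ hX₂ _ (measurableSet_spinPart hDm)]
  refine measure_le_of_local_le (fun F D hDm hDup hDF => ?_) (measurableSet_spinPart hDm)
    hD.isUpperSet
  refine (ENNReal.toReal_le_toReal (measure_ne_top _ _) (measure_ne_top _ _)).1 ?_
  rw [hcond _ hX₁ _ hDm, hcond _ hX₂ _ hDm, ENNReal.toReal_mul, ENNReal.toReal_mul,
    ENNReal.toReal_inv, ENNReal.toReal_inv]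
  change (P.real X₁)⁻¹ * P.real _ ≤ (P.real X₂)⁻¹ * P.real _
  rw [inv_mul_eq_div, inv_mul_eq_div, div_le_div_iff₀ hpos₁ hpos₂]
  exact h F D hDm hDup hDF

/-! ### Edge boundaries are barriers -/

theorem mem_edgeBoundary_iff {V : Set Vertex} {e : Edge} {v w : Vertex} (he : e.1 = s(v, w)) :
    e ∈ edgeBoundary V ↔ ¬ (v ∈ V ↔ w ∈ V) := by
  constructor
  · rintro ⟨x, hx, y, hy, hxy⟩
    rw [he] at hxy
    rcases Sym2.eq_iff.1 hxy with ⟨rfl, rfl⟩ | ⟨rfl, rfl⟩ <;> tauto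
  · intro h
    by_cases hv : v ∈ V
    · exact ⟨v, hv, w, by tauto, he⟩
    · exact ⟨w, by tauto, v, hv, he.trans Sym2.eq_swap⟩

theorem removeEdges_edgeBoundary_adj {V : Set Vertex} {v w : Vertex} :
    (removeEdges (edgeBoundary V)).Adj v w ↔
      triangularLattice.Adj v w ∧ (v ∈ V ↔ w ∈ V) := by
  rw [removeEdges, SimpleGraph.deleteEdges_adj]
  refine and_congr_right fun h => ?_
  have h1 := mem_edgeBoundary_iff (V := V) (e := ⟨s(v, w), h⟩) rfl
  rw [← not_iff_not, ← h1, not_not]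
  constructor
  · rintro ⟨e, he, hvw⟩
    have : e = ⟨s(v, w), h⟩ := Subtype.ext hvw
    rwa [← this]
  · intro h2
    exact ⟨_, h2, rfl⟩

theorem edgeBoundary_finite {V : Set Vertex} (hV : V.Finite) : (edgeBoundary V).Finite := by
  obtain ⟨N, hN⟩ := exists_mem_box hV.toFinset
  refine (edgesIn (box (N + 1))).finite_toSet.subset ?_
  rintro e ⟨x, hx, y, -, hxy⟩
  have hx' := hN (hV.mem_toFinset.2 hx)
  have hadj : triangularLattice.Adj x y := by
    have := e.2
    rwa [hxy] at this
  change (x.1 - y.1) ^ 2 - (x.1 - y.1) * (x.2 - y.2) + (x.2 - y.2) ^ 2 = 1 at hadj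
  set a := x.1 - y.1 with ha
  set b := x.2 - y.2 with hb
  -- From $4(a^2-ab+b^2)=3a^2+(2b-a)^2$ one gets $3a^2\le 4$; likewise for `b`. Neighbours thus stay
  -- in the box enlarged by one.
  have ha1 : a ≤ 1 := by nlinarith [sq_nonneg (2 * b - a)]
  have ha2 : -1 ≤ a := by nlinarith [sq_nonneg (2 * b - a)]
  have hb1 : b ≤ 1 := by nlinarith [sq_nonneg (2 * a - b)]
  have hb2 : -1 ≤ b := by nlinarith [sq_nonneg (2 * a - b)]
  rw [Finset.mem_coe, mem_edgesIn, hxy]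
  simp only [Sym2.mem_iff, forall_eq_or_imp, forall_eq]
  simp only [box, Finset.mem_product, Finset.mem_Icc] at hx' ⊢
  push_cast
  omega

theorem reachable_of_forall_succ {G : SimpleGraph Vertex} {f : ℤ → Vertex}
    (h : ∀ k, G.Reachable (f k) (f (k + 1))) (k k' : ℤ) : G.Reachable (f k) (f k') := by
  have key : ∀ k k' : ℤ, k ≤ k' → G.Reachable (f k) (f k') := by
    intro k k' hkk'
    induction k', hkk' using Int.leInduction with
    | base => exact SimpleGraph.Reachable.refl _
    | succ n _ ih => exact ih.trans (h n)
  rcases le_total k k' with hk | hk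
  · exact key _ _ hk
  · exact (key _ _ hk).symm

/-- Outside a box that contains `V`, all vertices are connected without crossing the boundary. -/
theorem reachable_outside_box {V : Set Vertex} {N : ℕ} (hV : V ⊆ box N) {v : Vertex}
    (hv : v ∉ box N) :
    (removeEdges (edgeBoundary V)).Reachable v ((N : ℤ) + 1, (N : ℤ) + 1) := by
  have hstep : ∀ v w : Vertex, v ∉ box N → w ∉ box N → triangularLattice.Adj v w →
      (removeEdges (edgeBoundary V)).Reachable v w := fun v w hv hw h =>
    (removeEdges_edgeBoundary_adj.2 ⟨h, fun h' => (hv (hV h')).elim,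
      fun h' => (hw (hV h')).elim⟩).reachable
  have hrow : ∀ l : ℤ, (l < -N ∨ N < l) → ∀ k k' : ℤ,
      (removeEdges (edgeBoundary V)).Reachable (k, l) (k', l) := by
    intro l hl
    have hout : ∀ k : ℤ, ((k, l) : Vertex) ∉ box N := by
      intro k
      simp only [box, Finset.mem_product, Finset.mem_Icc]
      omega
    refine reachable_of_forall_succ (f := fun k => (k, l)) fun k => hstep _ _ (hout _) (hout _) ?_
    simp [triangularLattice]
  have hcol : ∀ k : ℤ, (k < -N ∨ N < k) → ∀ l l' : ℤ,
      (removeEdges (edgeBoundary V)).Reachable (k, l) (k, l') := by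
    intro k hk
    have hout : ∀ l : ℤ, ((k, l) : Vertex) ∉ box N := by
      intro l
      simp only [box, Finset.mem_product, Finset.mem_Icc]
      omega
    refine reachable_of_forall_succ (f := fun l => (k, l)) fun l => hstep _ _ (hout _) (hout _) ?_
    simp [triangularLattice]
  obtain ⟨k, l⟩ := v
  -- One row and one column suffice: first move along the line that misses the box, up to coordinate
  -- `N + 1`, then along the line through the corner.
  by_cases hk : k < -N ∨ N < k
  · exact (hcol k hk l (N + 1)).trans (hrow _ (by omega) _ _)
  · have hl : l < -N ∨ N < l := by
      simp only [box, Finset.mem_product, Finset.mem_Icc] at hv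
      omega
    exact (hrow l hl k (N + 1)).trans (hcol _ (by omega) _ _)

theorem isBarrier_edgeBoundary {V : Set Vertex} (hV : V.Finite) (hne : V.Nonempty) :
    IsBarrier (edgeBoundary V) := by
  obtain ⟨N, hN⟩ := exists_mem_box hV.toFinset
  have hVN : V ⊆ box N := fun v hv => hN (hV.mem_toFinset.2 hv)
  set G := removeEdges (edgeBoundary V)
  set z : Vertex := ((N : ℤ) + 1, (N : ℤ) + 1)
  have hz : z ∉ V := by
    intro h
    have := hVN h
    rw [Finset.mem_coe] at this
    simp only [box, Finset.mem_product, Finset.mem_Icc, z] at this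
    omega
  have hcomp : ∀ v ∉ box N, G.connectedComponentMk v = G.connectedComponentMk z := fun v hv =>
    SimpleGraph.ConnectedComponent.eq.2 (reachable_outside_box hVN hv)
  refine ⟨edgeBoundary_finite hV, ?_, G.connectedComponentMk z, ?_, ?_⟩
  · obtain ⟨v, hv⟩ := hne
    refine ⟨G.connectedComponentMk v, G.connectedComponentMk z, fun h => hz ?_⟩
    refine mem_of_reachable (T := V) (fun a a' haa ha => ?_) hv
      (SimpleGraph.ConnectedComponent.eq.1 h)
    exact (removeEdges_edgeBoundary_adj.1 haa).2.1 ha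
  · refine ((box N).finite_toSet.infinite_compl).mono fun v hv => ?_
    exact hcomp v (by simpa using hv)
  · intro c hc
    -- An infinite component leaves the box, and everything outside the box is connected to `z`.
    obtain ⟨v, hv, hvN⟩ := hc.exists_notMem_finset (box N)
    rw [← hcomp v hvN]
    exact hv.symm

end TriFK

/-! ### Assembly of the theorem -/

open TriFK in
theorem lemma10 (β : ℝ) (hβ0 : 0 ≤ β) (hβ : β < TriFK.betaC) (r : unitInterval)
    (ν : MeasureTheory.Measure TriFK.EdgeConfig)
    (hν : TriFK.IsRandomClusterMeasure (1 - Real.exp (-β)) 2 ν)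
    (V : Set TriFK.Vertex) (hVfin : V.Finite)
    (hVconn : (TriFK.triangularLattice.induce V).Connected) :
    TriFK.IsBarrier (TriFK.edgeBoundary V) ∧
    (∀ D : Set TriFK.Config, MeasurableSet D → TriFK.IsIncreasing D →
      ProbabilityTheory.cond (TriFK.divideAndColour ν r) (TriFK.allMinus V) D ≤
        ProbabilityTheory.cond (TriFK.divideAndColour ν r)
          (TriFK.allClosed (TriFK.edgeBoundary V)) D) ∧
    (∀ D : Set TriFK.Config,
      MeasurableSet[TriFK.spinSigma (TriFK.ext (TriFK.edgeBoundary V))] D →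
      TriFK.IsIncreasing D →
      ProbabilityTheory.cond (TriFK.divideAndColour ν r) (TriFK.allMinus V) D ≤
        ProbabilityTheory.cond (TriFK.divideAndColour ν r)
          (TriFK.allClosed (TriFK.edgeBoundary V) ∩ TriFK.allMinus V) D) := by
  have hne : V.Nonempty := Set.nonempty_coe_sort.1 hVconn.nonempty
  have := hν.isProbabilityMeasure
  set p := 1 - Real.exp (-β) with hp
  have hp0 : 0 ≤ p := by
    have : Real.exp (-β) ≤ 1 := Real.exp_le_one_iff.2 (by linarith)
    linarith
  have hp1 : p < 1 := by
    have := Real.exp_pos (-β)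
    linarith
  set U := hVfin.toFinset
  have hUV : ∀ v, v ∈ U ↔ v ∈ V := fun v => hVfin.mem_toFinset
  have hUne : U.Nonempty := hVfin.toFinset_nonempty.2 hne
  set B := (edgeBoundary_finite hVfin).toFinset
  have hBV : ∀ e, e ∈ B ↔ e ∈ edgeBoundary V := fun e => (edgeBoundary_finite hVfin).mem_toFinset
  have hB : ∀ e ∈ B, ∃ v ∈ e.1, v ∈ U := by
    intro e he
    obtain ⟨x, hx, y, -, hxy⟩ := (hBV e).1 he
    exact ⟨x, by simp [hxy], (hUV x).2 hx⟩
  have hB' : ∀ e ∉ B, (∀ v ∈ e.1, v ∈ U) ∨ ∀ v ∈ e.1, v ∉ U := by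
    intro e he
    obtain ⟨v, w, hvw, -⟩ := exists_ends e
    rw [hBV, mem_edgeBoundary_iff hvw, not_not] at he
    simp only [hvw, Sym2.mem_iff, forall_eq_or_imp, forall_eq, hUV]
    tauto
  have hI : allMinus V = closedSpinEvent ∅ (minusOn U) := by
    ext ω
    simp [allMinus, closedSpinEvent, minusOn, hUV]
  have hC : allClosed (edgeBoundary V) = closedSpinEvent B Set.univ := by
    ext ω
    simp [allClosed, closedSpinEvent, hBV]
  have hCI : allClosed (edgeBoundary V) ∩ allMinus V = closedSpinEvent B (minusOn U) := by
    ext ω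
    simp [allMinus, allClosed, closedSpinEvent, minusOn, hUV, hBV]
  have hinter : ∀ (B : Finset Edge) (X D : Set SpinConfig),
      closedSpinEvent B X ∩ Prod.snd ⁻¹' D = closedSpinEvent B (D ∩ X) := by
    intro B X D
    ext ω
    simp only [closedSpinEvent, Set.mem_inter_iff, Set.mem_ofPred_eq, Set.mem_preimage]
    tauto
  have hU := measurableSet_minusOn U
  rw [hCI, hC, hI]
  refine ⟨isBarrier_edgeBoundary hVfin hne, fun D hDm hD => ?_, fun D hDm hD => ?_⟩
  · refine cond_le_cond_of_local (measurableSet_closedSpinEvent hU)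
      (measurableSet_closedSpinEvent MeasurableSet.univ) (fun _ => ?_)
      (fun F D hD hup hF => ?_) hDm hD
    · have h := divideAndColour_minus_pos (r := r) hp0 hp1 hν B ∅ (.inr rfl)
      have h' : minusOn ∅ = Set.univ := by simp [minusOn]
      rwa [h'] at h
    · rw [hinter, hinter, Set.inter_univ]
      exact divideAndColour_minus_mul_closed_le hp0 hp1 hν hD hup hF hB
  · have hle : spinSigma (ext (edgeBoundary V)) ≤ (inferInstance : MeasurableSpace Config) :=
      iSup₂_le fun x _ => ((measurable_pi_apply x).comp measurable_snd).comap_le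
    refine cond_le_cond_of_local (measurableSet_closedSpinEvent hU)
      (measurableSet_closedSpinEvent hU) (fun h => ?_)
      (fun F D hD hup hF => ?_) (hle _ hDm) hD
    -- If $I$ has positive probability then $r\ne 1$, so $C(B)\cap I$ has positive probability as
    -- well.
    · refine divideAndColour_minus_pos hp0 hp1 hν B U (.inl ?_)
      refine lt_of_le_of_ne measureReal_nonneg fun h0 => h ?_
      exact divideAndColour_minus_eq_zero hp0 hp1 hν hUne h0.symm
    · rw [hinter, hinter]
      exact divideAndColour_minus_mul_closed_minus_le hp0 hp1 hν hD hup hF hB hB'
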